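/- **Characterization of undesired equilibria (fully actuated linear planar system, center of the obstacle an eigenvector).** Setting. Let $A,B,K\in\mathbb{R}^{2\times 2}$ with $B$ invertible, and suppose that $\tilde A:=A-BK$ is Hurwitz. Let $x_c\in\mathbb{R}^2$, $r>0$, $h(x)=\|x-x_c\|^2-r^2$, with safe set $\{h\ge 0\}$, and assume $h(0)>0$. Let $G(x)=B^\top B$ for all $x$. Let $\alpha:\mathbb{R}\to\mathbb{R}$ be of extended class $\mathcal K_\infty$ (that is, $\alpha(0)=0$, $\alpha$ is strictly increasing and $\alpha(s)\to\pm\infty$ as $s\to\pm\infty$), differentiable, with $\alpha'(0)>0$. Put $\eta(x)=\nabla h(x)^\top\tilde A x+\alpha(h(x))$ and consider the filtered system $$\dot x=F(x):=\tilde A x+Bv(x),\qquad v(x)=\begin{cases}0,&\eta(x)\ge 0,\\[2pt] -\dfrac{\eta(x)\,G(x)^{-1}B^\top\nabla h(x)}{\|B^\top\nabla h(x)\|^2_{G(x)^{-1}}},&\eta(x)<0,\end{cases}$$ where $\|w\|_M^2=w^\top M w$. Let $\mathcal E$ (resp. $\hat{\mathcal E}$) be the set of $x\in\mathbb{R}^2$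 for which there is $\delta\in\mathbb{R}$ (resp. $\delta<0$) with $$h(x)=0,\qquad \tilde A x=\delta\,B\,G(x)^{-1}B^\top\nabla h(x).$$ An equilibrium of $F$ is *degenerate* if the Jacobian of $F$ there has an eigenvalue with zero real part; it is a *saddle point* if no eigenvalue of the Jacobian has zero real part, at least one has negative real part and at least one has positive real part; *asymptotically stable* means Lyapunov stable and locally attractive. Claim. Suppose that $x_c$ is an eigenvector of $\tilde A$, with eigenvalue $\lambda$. Then exactly one of the following holds: 1. $|\mathcal E|=2$, $|\hat{\mathcal E}|=1$, and $\hat{\mathcal E}$ consists of a degenerate equilibrium; 2. $|\mathcal E|=2$, $|\hat{\mathcal E}|=1$, and $\hat{\mathcal E}$ consists of a saddle point; 3. $|\mathcal E|=3$, $|\hat{\mathcal E}|=2$, and $\hat{\mathcal E}$ consists of a saddle point and a degenerate equilibrium; 4. $|\mathcal E|=4$, $|\hat{\mathcal E}|=3$, and $\hat{\mathcal E}$ consists of an asymptotically stable equilibrium and two saddle points. Moreover, which case occurs is determined as follows. (a) Suppose $\tilde A$ is diagonalizable: let $v_i=x_c/\|x_c\|$ and let $v_j$ be such that $\|v_j\|=1$,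 $\tilde A v_j=\lambda' v_j$, and $v_i,v_j$ are linearly independent. Put $\kappa=\dfrac{(\lambda-\lambda')^2r^2}{\lambda^2\|x_c\|^2}$. If $\kappa\ne 1$, then case 2 holds if $(v_i^\top v_j)^2<1-\kappa$, case 3 holds if $(v_i^\top v_j)^2=1-\kappa$, and case 4 holds if $(v_i^\top v_j)^2>1-\kappa$. If $\kappa=1$, then case 1 holds if $v_i^\top v_j=0$, and case 3 holds if $v_i^\top v_j\neq 0$. (b) Suppose $\tilde A$ is not diagonalizable: let $v_1=x_c/\|x_c\|$ and let $v_2$ be such that $\tilde A v_2=\lambda v_2+v_1$. Then case 2 holds if $(v_1^\top v_2)^2<\|v_2\|^2-\frac{r^2}{\lambda^2\|x_c\|^2}$, case 3 holds if equality holds, and case 4 holds if $(v_1^\top v_2)^2>\|v_2\|^2-\frac{r^2}{\lambda^2\|x_c\|^2}$. -/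

import Mathlib

noncomputable section

/-- The Euclidean plane. -/
abbrev Plane : Type := EuclideanSpace ℝ (Fin 2)

/-! ### Equilibria of planar vector fields -/

/-- The complex eigenvalues of a real linear endomorphism of the plane. -/
def complexEigenvalues (T : Plane →ₗ[ℝ] Plane) : Set ℂ :=
  {z | (T.charpoly.map (algebraMap ℝ ℂ)).IsRoot z}

/-- A real matrix is Hurwitz if all its complex eigenvalues have negative real part. -/
def IsHurwitz (M : Matrix (Fin 2) (Fin 2) ℝ) : Prop :=
  ∀ z ∈ complexEigenvalues M.toEuclideanLin, z.re < 0

/-- An equilibrium at which the Jacobian exists and has an eigenvalue with zero real part. -/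
def IsDegenerateEquilibrium (F : Plane → Plane) (p : Plane) : Prop :=
  F p = 0 ∧ ∃ J : Plane →L[ℝ] Plane, HasFDerivAt F J p ∧
    ∃ z ∈ complexEigenvalues (J : Plane →ₗ[ℝ] Plane), z.re = 0

/-- A hyperbolic equilibrium (no eigenvalue of the Jacobian has zero real part) with at least one
eigenvalue with negative and at least one with positive real part. -/
def IsSaddlePoint (F : Plane → Plane) (p : Plane) : Prop :=
  F p = 0 ∧ ∃ J : Plane →L[ℝ] Plane, HasFDerivAt F J p ∧
    (∀ z ∈ complexEigenvalues (J : Plane →ₗ[ℝ] Plane), z.re ≠ 0) ∧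
    (∃ z ∈ complexEigenvalues (J : Plane →ₗ[ℝ] Plane), z.re < 0) ∧
    (∃ z ∈ complexEigenvalues (J : Plane →ₗ[ℝ] Plane), 0 < z.re)

/-- Lyapunov stability. Solutions on every interval `[0, T)` are considered, so that solutions
that leave a neighbourhood of `p` and then escape in finite time are taken into account. -/
def IsLyapunovStable (F : Plane → Plane) (p : Plane) : Prop :=
  ∀ ε > 0, ∃ d > 0, ∀ T > 0, ∀ x : ℝ → Plane,
    IsIntegralCurveOn x (fun _ => F) (Set.Ico 0 T) → dist (x 0) p < d →
      ∀ t ∈ Set.Ico 0 T, dist (x t) p < ε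

/-- Local attractivity: solutions starting close to `p` converge to `p`. -/
def IsLocallyAttractive (F : Plane → Plane) (p : Plane) : Prop :=
  ∃ d > 0, ∀ x : ℝ → Plane,
    IsIntegralCurveOn x (fun _ => F) (Set.Ici 0) → dist (x 0) p < d →
      Filter.Tendsto x Filter.atTop (nhds p)

/-- An asymptotically stable equilibrium: Lyapunov stable and locally attractive. -/
def IsAsymptoticallyStable (F : Plane → Plane) (p : Plane) : Prop :=
  F p = 0 ∧ IsLyapunovStable F p ∧ IsLocallyAttractive F p

/-! ### Safety filters for linear planar systems with a circular obstacle -/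

/-- Extended class `K_∞` functions. -/
structure IsExtendedClassKInfty (β : ℝ → ℝ) : Prop where
  map_zero : β 0 = 0
  strictMono : StrictMono β
  tendsto_atTop : Filter.Tendsto β Filter.atTop Filter.atTop
  tendsto_atBot : Filter.Tendsto β Filter.atBot Filter.atBot

/-- The data of the filtered system: the plant `x' = A x + B u`, the nominal feedback `u = -K x`,
the weight `G` of the safety filter, the center `xc` and the radius `r` of the circular obstacle,
and the function `α` of the barrier condition. -/
structure FilterData where
  /-- drift matrix -/
  A : Matrix (Fin 2) (Fin 2) ℝ
  /-- input matrix -/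
  B : Matrix (Fin 2) (Fin 2) ℝ
  /-- nominal gain -/
  K : Matrix (Fin 2) (Fin 2) ℝ
  /-- weight of the quadratic program -/
  G : Plane → Matrix (Fin 2) (Fin 2) ℝ
  /-- center of the obstacle -/
  xc : Plane
  /-- radius of the obstacle -/
  r : ℝ
  /-- barrier rate -/
  α : ℝ → ℝ

namespace FilterData

/-- The nominal closed-loop matrix `Ã = A - B K`. -/
def Atilde (S : FilterData) : Matrix (Fin 2) (Fin 2) ℝ := S.A - S.B * S.K

/-- The barrier function `h x = ‖x - xc‖² - r²`; the safe set is `{h ≥ 0}`. -/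
def h (S : FilterData) (x : Plane) : ℝ := ‖x - S.xc‖ ^ 2 - S.r ^ 2

/-- `η x = ∇h(x)ᵀ Ã x + α (h x)`. -/
def eta (S : FilterData) (x : Plane) : ℝ :=
  inner ℝ (gradient S.h x) (S.Atilde.toEuclideanLin x) + S.α (S.h x)

/-- The vector `Bᵀ ∇h(x)`. -/
def inputGradient (S : FilterData) (x : Plane) : Plane :=
  S.B.transpose.toEuclideanLin (gradient S.h x)

/-- The safety filter `v`: zero if `η x ≥ 0`, and
`- η(x) G(x)⁻¹ Bᵀ ∇h(x) / ‖Bᵀ ∇h(x)‖²_{G(x)⁻¹}` if `η x < 0`. -/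
def safetyFilter (S : FilterData) (x : Plane) : Plane :=
  if 0 ≤ S.eta x then 0
  else -(S.eta x / inner ℝ (S.inputGradient x) ((S.G x)⁻¹.toEuclideanLin (S.inputGradient x))) •
    (S.G x)⁻¹.toEuclideanLin (S.inputGradient x)

/-- The filtered closed-loop vector field `F x = (A - B K) x + B v(x)`. -/
def closedLoop (S : FilterData) (x : Plane) : Plane :=
  S.Atilde.toEuclideanLin x + S.B.toEuclideanLin (S.safetyFilter x)

/-- `(x, δ)` solves `h x = 0` and `Ã x = δ B G(x)⁻¹ Bᵀ ∇h(x)`. -/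
def SolvesEquilibriumCondition (S : FilterData) (x : Plane) (δ : ℝ) : Prop :=
  S.h x = 0 ∧
    S.Atilde.toEuclideanLin x =
      δ • S.B.toEuclideanLin ((S.G x)⁻¹.toEuclideanLin (S.inputGradient x))

/-- The set `E` of potential undesired equilibria. -/
def potentialUndesiredEquilibria (S : FilterData) : Set Plane :=
  {x | ∃ δ : ℝ, S.SolvesEquilibriumCondition x δ}

/-- The set `Ê` of undesired equilibria. -/
def undesiredEquilibria (S : FilterData) : Set Plane :=
  {x | ∃ δ : ℝ, δ < 0 ∧ S.SolvesEquilibriumCondition x δ}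

/-- `safetyFilter` is the unique minimizer of `‖θ‖²_{G(x)}` subject to
`∇h(x)ᵀ (Ã x + B θ) + α (h x) ≥ 0`. -/
theorem safetyFilter_isUniqueMinimizer (S : FilterData) (x : Plane) (hG : (S.G x).PosDef)
    (hx : S.inputGradient x ≠ 0) :
    0 ≤ inner ℝ (gradient S.h x)
        (S.Atilde.toEuclideanLin x + S.B.toEuclideanLin (S.safetyFilter x)) + S.α (S.h x) ∧
    ∀ θ : Plane,
      0 ≤ inner ℝ (gradient S.h x)
        (S.Atilde.toEuclideanLin x + S.B.toEuclideanLin θ) + S.α (S.h x) →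
      θ ≠ S.safetyFilter x →
      inner ℝ (S.safetyFilter x) ((S.G x).toEuclideanLin (S.safetyFilter x)) <
        inner ℝ θ ((S.G x).toEuclideanLin θ) := by
  have hsymm : ∀ a b : Plane, inner ℝ a ((S.G x).toEuclideanLin b) =
      inner ℝ ((S.G x).toEuclideanLin a) b := fun a b =>
    ((Matrix.isSymmetric_toEuclideanLin_iff.2 hG.isHermitian) a b).symm
  have hpos : ∀ M : Matrix (Fin 2) (Fin 2) ℝ, M.PosDef → ∀ a : Plane, a ≠ 0 →
      0 < inner ℝ a (M.toEuclideanLin a) := by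
    intro M hM a ha
    have h1 := hM.dotProduct_mulVec_pos (x := a.ofLp) (by simpa using ha)
    rw [EuclideanSpace.inner_eq_star_dotProduct, dotProduct_comm]
    simpa using h1
  have hinv : ∀ a : Plane, (S.G x).toEuclideanLin ((S.G x)⁻¹.toEuclideanLin a) = a := by
    intro a
    have hu : IsUnit (S.G x).det := (Matrix.isUnit_iff_isUnit_det _).1 hG.isUnit
    rw [Matrix.toLpLin_apply, Matrix.toLpLin_apply, Matrix.mulVec_mulVec,
      Matrix.mul_nonsing_inv _ hu, Matrix.one_mulVec]
  have hadj : ∀ θ : Plane, inner ℝ (gradient S.h x) (S.B.toEuclideanLin θ) =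
      inner ℝ (S.inputGradient x) θ := by
    intro θ
    have h1 := Matrix.toEuclideanLin_conjTranspose_eq_adjoint S.B
    rw [Matrix.conjTranspose_eq_transpose_of_trivial] at h1
    rw [inputGradient, h1, LinearMap.adjoint_inner_left]
  have hcon : ∀ θ : Plane, inner ℝ (gradient S.h x)
      (S.Atilde.toEuclideanLin x + S.B.toEuclideanLin θ) + S.α (S.h x) =
      S.eta x + inner ℝ (S.inputGradient x) θ := by
    intro θ
    rw [inner_add_right, hadj, eta]
    ring
  simp only [hcon]
  by_cases hη : 0 ≤ S.eta x
  · have hv : S.safetyFilter x = 0 := if_pos hη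
    rw [hv]
    refine ⟨by simpa using hη, fun θ _ hθ => ?_⟩
    simpa using hpos _ hG θ hθ
  · set w := S.inputGradient x with hw
    set q : ℝ := inner ℝ w ((S.G x)⁻¹.toEuclideanLin w) with hq
    have hq0 : 0 < q := hpos _ hG.inv w hx
    have hv : S.safetyFilter x = -(S.eta x / q) • (S.G x)⁻¹.toEuclideanLin w := if_neg hη
    set v := S.safetyFilter x with hvdef
    have hwv : inner ℝ w v = -S.eta x := by
      rw [hv, inner_smul_right, ← hq]
      field_simp
    have hGv : (S.G x).toEuclideanLin v = -(S.eta x / q) • w := by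
      rw [hv, map_smul, hinv]
    refine ⟨by rw [hwv]; simp, fun θ hθ hne => ?_⟩
    obtain ⟨d, rfl⟩ : ∃ d, θ = v + d := ⟨θ - v, by abel⟩
    have hd : d ≠ 0 := by
      rintro rfl
      simp at hne
    rw [inner_add_right, hwv] at hθ
    have hcross : 0 ≤ inner ℝ ((S.G x).toEuclideanLin v) d := by
      rw [hGv, inner_smul_left]
      have h1 : 0 ≤ -(S.eta x / q) := by
        have := div_nonneg (neg_nonneg.2 (not_le.1 hη).le) hq0.le
        rwa [neg_div] at this
      simpa using mul_nonneg h1 (by linarith : (0 : ℝ) ≤ inner ℝ w d)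
    have hdd := hpos _ hG d hd
    have hcross' := hcross
    rw [real_inner_comm] at hcross'
    rw [map_add, inner_add_left, inner_add_right, inner_add_right, hsymm v d]
    linarith

end FilterData

/-! ### The possible configurations of undesired equilibria -/

/-- Labels of the four configurations. -/
inductive EquilibriumConfiguration : Type
  | oneDegenerate
  | oneSaddle
  | saddleAndDegenerate
  | twoSaddlesAndStable

/-- The meaning of the four labels for the filtered system `S`. -/
def FilterData.HasConfiguration (S : FilterData) : EquilibriumConfiguration → Prop
  | .oneDegenerate =>
      S.potentialUndesiredEquilibria.ncard = 2 ∧ S.undesiredEquilibria.ncard = 1 ∧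
      ∃ p, S.undesiredEquilibria = {p} ∧ IsDegenerateEquilibrium S.closedLoop p
  | .oneSaddle =>
      S.potentialUndesiredEquilibria.ncard = 2 ∧ S.undesiredEquilibria.ncard = 1 ∧
      ∃ p, S.undesiredEquilibria = {p} ∧ IsSaddlePoint S.closedLoop p
  | .saddleAndDegenerate =>
      S.potentialUndesiredEquilibria.ncard = 3 ∧ S.undesiredEquilibria.ncard = 2 ∧
      ∃ p q, S.undesiredEquilibria = {p, q} ∧
        IsSaddlePoint S.closedLoop p ∧ IsDegenerateEquilibrium S.closedLoop q
  | .twoSaddlesAndStable =>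
      S.potentialUndesiredEquilibria.ncard = 4 ∧ S.undesiredEquilibria.ncard = 3 ∧
      ∃ p q s, S.undesiredEquilibria = {p, q, s} ∧
        IsAsymptoticallyStable S.closedLoop p ∧
        IsSaddlePoint S.closedLoop q ∧ IsSaddlePoint S.closedLoop s

end

/-! Because G = BᵀB with `B` invertible, B G⁻¹ Bᵀ is the identity. The equilibrium condition becomes
Ãx = 2δ(x - xc) on the circle of radius r about xc, and the active filter only adds a radial
correction.

In an orthonormal frame whose first vector points to xc, Ã is upper triangular with diagonal `lam`,
`mu` and corner `b`. With c = ‖xc‖, y = x - xc, u = lam - mu and k = -lam c > 0, the condition reads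
(lam - 2δ)y₁ + b y₂ = k and (mu - 2δ)y₂ = 0. Either y₂ = 0, so y = (±r, 0), where only +r has δ < 0;
or 2δ = mu < 0 and y is an off-axis point of the circle on the line u y₁ + b y₂ = k. Counting
equilibria is thus intersecting a line with a circle (`mem_undesiredEquilibria_iff`,
`line_circle_iff`), governed by the sign of (u² + b²)r² - k² and by whether the line passes through
(r, 0), that is, whether ur = k.

In the tangent-normal frame the Jacobian at such a point is triangular (`exists_linearization`): the
normal eigenvalue is -α'(0) < 0, so the sign of the tangential one decides the type. Up to a
positive factor it is k - ur at (r, 0) and y₂(u y₂ - b y₁) elsewhere, where u y₂ - b y₁ is plus or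
minus the root of the discriminant. Stability is obtained from a weighted quadratic Lyapunov
function. The criteria (a) and (b) are the same discriminant written through the coordinates of the
second (generalized) eigenvector. -/

noncomputable section

/-! ### Stability from a quadratic Lyapunov function -/

/-- A nonnegative quantity that decays at an exponential rate below the level `ρ` stays below
every level it starts from, and decays exponentially. -/
theorem le_mul_exp_of_deriv_le {V V' : ℝ → ℝ} {T ρ c W : ℝ} (hc : 0 < c)
    (hcont : ContinuousOn V (Set.Ico 0 T))
    (hderiv : ∀ t ∈ Set.Ico 0 T, HasDerivWithinAt V (V' t) (Set.Ici t) t)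
    (hdecay : ∀ t ∈ Set.Ico 0 T, V t < ρ → V' t ≤ -(2 * c) * V t)
    (hW : 0 < W) (hWρ : W < ρ) (h0 : V 0 ≤ W) :
    ∀ t ∈ Set.Ico 0 T, V t ≤ W * Real.exp (-c * t) := by
  intro t ht
  have hsub : Set.Icc 0 t ⊆ Set.Ico 0 T := fun s hs => ⟨hs.1, hs.2.trans_lt ht.2⟩
  -- The barrier decays at rate c, half of the available 2c, so that at a contact point the
  -- derivative inequality is strict.
  refine image_le_of_deriv_right_lt_deriv_boundary (f' := V')
    (B := fun s => W * Real.exp (-c * s)) (B' := fun s => W * (Real.exp (-c * s) * (-c * 1)))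
    (hcont.mono hsub) (fun s hs => hderiv s (hsub ⟨hs.1, hs.2.le⟩)) (by simpa using h0)
    (fun s => (((hasDerivAt_id s).const_mul (-c)).exp).const_mul W) ?_ ⟨ht.1, le_rfl⟩
  intro s hs hVs
  have hexp : Real.exp (-c * s) ≤ 1 := Real.exp_le_one_iff.2 (by nlinarith [hs.1])
  have hpos : 0 < W * Real.exp (-c * s) := by positivity
  have hlt : V s < ρ := by
    rw [hVs]
    nlinarith
  have := hdecay s (hsub ⟨hs.1, hs.2.le⟩) hlt
  rw [hVs] at this
  nlinarith

/-- An equilibrium whose linearization `J` satisfies the strict Lyapunov inequality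
`⟪L d, L (J d)⟫ ≤ -c ‖L d‖²` for some injective `L` is asymptotically stable. -/
theorem isAsymptoticallyStable_of_inner_le {F : Plane → Plane} {p : Plane}
    {J L : Plane →L[ℝ] Plane} {c K : ℝ} (hF : F p = 0) (hJ : HasFDerivAt F J p) (hc : 0 < c)
    (hK : 0 < K) (hL : ∀ d, ‖d‖ ≤ K * ‖L d‖)
    (hLJ : ∀ d, inner ℝ (L d) (L (J d)) ≤ -c * ‖L d‖ ^ 2) :
    IsAsymptoticallyStable F p := by
  -- With this tolerance the nonlinear remainder, measured through `L`, consumes at most half of the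
  -- rate c; the `+ 1` keeps the denominator positive.
  have hε : 0 < c / (2 * (‖L‖ * K + 1)) := by positivity
  have hlin := hJ.isLittleO.bound hε
  obtain ⟨ρ, hρ, hball⟩ := Metric.eventually_nhds_iff.1 hlin
  have hle : ∀ x : Plane, ‖L (x - p)‖ ^ 2 < (ρ / K) ^ 2 →
      2 * inner ℝ (L (x - p)) (L (F x)) ≤ -(2 * (c / 2)) * ‖L (x - p)‖ ^ 2 := by
    intro x hx
    have h1 : ‖L (x - p)‖ < ρ / K := lt_of_pow_lt_pow_left₀ 2 (by positivity) hx
    have h2 : dist x p < ρ := by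
      rw [dist_eq_norm]
      calc ‖x - p‖ ≤ K * ‖L (x - p)‖ := hL _
        _ < K * (ρ / K) := by gcongr
        _ = ρ := by field_simp
    have h3 := hball h2
    rw [hF, sub_zero] at h3
    have h4 : inner ℝ (L (x - p)) (L (F x)) = inner ℝ (L (x - p)) (L (J (x - p))) +
        inner ℝ (L (x - p)) (L (F x - J (x - p))) := by
      rw [← inner_add_right, ← map_add, add_sub_cancel]
    have h5 : inner ℝ (L (x - p)) (L (F x - J (x - p))) ≤ c / 2 * ‖L (x - p)‖ ^ 2 := by
      calc inner ℝ (L (x - p)) (L (F x - J (x - p)))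
          ≤ ‖L (x - p)‖ * ‖L (F x - J (x - p))‖ := real_inner_le_norm _ _
        _ ≤ ‖L (x - p)‖ * (‖L‖ * (c / (2 * (‖L‖ * K + 1)) * (K * ‖L (x - p)‖))) := by
            gcongr
            refine (L.le_opNorm _).trans ?_
            gcongr
            refine h3.trans ?_
            gcongr
            exact hL _
        _ = (‖L‖ * K) / (‖L‖ * K + 1) * (c / 2 * ‖L (x - p)‖ ^ 2) := by
            field_simp
        _ ≤ 1 * (c / 2 * ‖L (x - p)‖ ^ 2) := by
            gcongr
            rw [div_le_one (by positivity)]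
            linarith
        _ = _ := one_mul _
    linarith [hLJ (x - p)]
  have hdecay : ∀ T > 0, ∀ x : ℝ → Plane,
      IsIntegralCurveOn x (fun _ => F) (Set.Ico 0 T) → ∀ W, 0 < W → W < (ρ / K) ^ 2 →
      ‖L (x 0 - p)‖ ^ 2 ≤ W →
      ∀ t ∈ Set.Ico 0 T, ‖L (x t - p)‖ ^ 2 ≤ W * Real.exp (-(c / 2) * t) := by
    intro T _ x hx W hW hWρ h0
    have hd : ∀ t ∈ Set.Ico 0 T, HasDerivWithinAt (fun t => ‖L (x t - p)‖ ^ 2)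
        (2 * inner ℝ (L (x t - p)) (L (F (x t)))) (Set.Ico 0 T) t := fun t ht =>
      (L.hasFDerivAt.comp_hasDerivWithinAt t ((hx t ht).sub_const p)).norm_sq
    refine le_mul_exp_of_deriv_le (V' := fun t => 2 * inner ℝ (L (x t - p)) (L (F (x t))))
      (half_pos hc) (fun t ht => (hd t ht).continuousWithinAt)
      (fun t ht => (hd t ht).mono_of_mem_nhdsWithin ?_) (fun t _ ht => hle _ ht) hW hWρ h0
    exact Filter.mem_of_superset (Ico_mem_nhdsGE ht.2) (Set.Ico_subset_Ico_left ht.1)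
  have hsmall : ∀ W > 0, ∃ d > 0, ∀ x : Plane, dist x p < d → ‖L (x - p)‖ ^ 2 ≤ W := by
    intro W hW
    have hcont : ContinuousAt (fun x : Plane => ‖L (x - p)‖ ^ 2) p := by fun_prop
    obtain ⟨d, hd, h⟩ := Metric.eventually_nhds_iff.1 (hcont.eventually_lt_const (by simpa using hW))
    exact ⟨d, hd, fun x hx => (h hx).le⟩
  refine ⟨hF, fun ε hε => ?_, ?_⟩
  · obtain ⟨W, hW, hWlt⟩ : ∃ W, 0 < W ∧ W < min ((ρ / K) ^ 2) ((ε / K) ^ 2) :=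
      exists_between (lt_min (by positivity) (by positivity))
    obtain ⟨d, hd, h⟩ := hsmall W hW
    refine ⟨d, hd, fun T hT x hx hx0 t ht => ?_⟩
    have h1 := hdecay T hT x hx W hW (hWlt.trans_le (min_le_left _ _)) (h _ hx0) t ht
    have hexp : Real.exp (-(c / 2) * t) ≤ 1 := Real.exp_le_one_iff.2 (by nlinarith [ht.1])
    have h2 : ‖L (x t - p)‖ ^ 2 < (ε / K) ^ 2 :=
      (h1.trans (mul_le_of_le_one_right hW.le hexp)).trans_lt (hWlt.trans_le (min_le_right _ _))
    have h3 := lt_of_pow_lt_pow_left₀ 2 (by positivity) h2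
    rw [dist_eq_norm]
    calc ‖x t - p‖ ≤ K * ‖L (x t - p)‖ := hL _
      _ < K * (ε / K) := by gcongr
      _ = ε := by field_simp
  · obtain ⟨W, hW, hWlt⟩ : ∃ W, 0 < W ∧ W < (ρ / K) ^ 2 := exists_between (by positivity)
    obtain ⟨d, hd, h⟩ := hsmall W hW
    refine ⟨d, hd, fun x hx hx0 => ?_⟩
    have h1 : ∀ t, 0 ≤ t → ‖L (x t - p)‖ ^ 2 ≤ W * Real.exp (-(c / 2) * t) := fun t ht =>
      -- The decay estimate lives on half-open intervals, so the horizon has to exceed t.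
      hdecay (t + 1) (by linarith) x
        (fun s hs => (hx s hs.1).mono Set.Ico_subset_Ici_self) W hW hWlt (h _ hx0) t ⟨ht, by simp⟩
    have h2 : Filter.Tendsto (fun t => W * Real.exp (-(c / 2) * t)) Filter.atTop (nhds 0) := by
      have h3 : Filter.Tendsto (fun t : ℝ => -(c / 2) * t) Filter.atTop Filter.atBot :=
        Filter.tendsto_id.const_mul_atTop_of_neg (by linarith)
      simpa using (Real.tendsto_exp_atBot.comp h3).const_mul W
    have h3 : Filter.Tendsto (fun t => ‖L (x t - p)‖ ^ 2) Filter.atTop (nhds 0) :=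
      squeeze_zero' (Filter.Eventually.of_forall fun _ => by positivity)
        (Filter.eventually_atTop.2 ⟨0, h1⟩) h2
    have h4 : Filter.Tendsto (fun t => K * √(‖L (x t - p)‖ ^ 2)) Filter.atTop (nhds 0) := by
      simpa using h3.sqrt.const_mul K
    rw [tendsto_iff_norm_sub_tendsto_zero]
    refine squeeze_zero (fun _ => norm_nonneg _) (fun t => ?_) h4
    rw [Real.sqrt_sq (norm_nonneg _)]
    exact hL _

/-! ### Coordinates in an orthonormal basis -/

section Frame

variable (e : OrthonormalBasis (Fin 2) ℝ Plane)

theorem inner_smul_add_smul (a b c d : ℝ) :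
    inner ℝ (a • e 0 + b • e 1) (c • e 0 + d • e 1) = a * c + b * d := by
  have h00 : inner ℝ (e 0) (e 0) = (1 : ℝ) := by simp
  have h11 : inner ℝ (e 1) (e 1) = (1 : ℝ) := by simp
  have h01 : inner ℝ (e 0) (e 1) = (0 : ℝ) := e.orthonormal.2 (by decide)
  have h10 : inner ℝ (e 1) (e 0) = (0 : ℝ) := e.orthonormal.2 (by decide)
  simp only [inner_add_left, inner_add_right, real_inner_smul_left, real_inner_smul_right, h00,
    h11, h01, h10]
  ring

theorem norm_sq_smul_add_smul (a b : ℝ) : ‖a • e 0 + b • e 1‖ ^ 2 = a ^ 2 + b ^ 2 := by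
  rw [← real_inner_self_eq_norm_sq, inner_smul_add_smul]
  ring

theorem smul_add_smul_inj {a b c d : ℝ} :
    a • e 0 + b • e 1 = c • e 0 + d • e 1 ↔ a = c ∧ b = d := by
  refine ⟨fun h => ?_, by rintro ⟨rfl, rfl⟩; rfl⟩
  have h1 : (a - c) • e 0 + (b - d) • e 1 = 0 := by
    rw [← sub_eq_zero] at h
    rw [← h]
    module
  have h2 := norm_sq_smul_add_smul e (a - c) (b - d)
  rw [h1, norm_zero] at h2
  constructor <;> nlinarith [sq_nonneg (a - c), sq_nonneg (b - d)]

theorem exists_eq_smul_add_smul (x : Plane) : ∃ a b : ℝ, x = a • e 0 + b • e 1 :=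
  ⟨inner ℝ (e 0) x, inner ℝ (e 1) x, by simpa using (e.sum_repr' x).symm⟩

end Frame

/-! ### Planar maps that are triangular in an orthonormal basis -/

theorem complexEigenvalues_eq_of_triangular (e : Module.Basis (Fin 2) ℝ Plane)
    {T : Plane →ₗ[ℝ] Plane} {a b d : ℝ} (h0 : T (e 0) = a • e 0)
    (h1 : T (e 1) = b • e 0 + d • e 1) : complexEigenvalues T = {(a : ℂ), (d : ℂ)} := by
  have hM : LinearMap.toMatrix e e T = !![a, b; 0, d] := by
    ext i j
    rw [LinearMap.toMatrix_apply]
    fin_cases i <;> fin_cases j <;> simp [h0, h1]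
  have hpoly : (T.charpoly.map (algebraMap ℝ ℂ)) =
      (Polynomial.X - Polynomial.C (a : ℂ)) * (Polynomial.X - Polynomial.C (d : ℂ)) := by
    rw [← LinearMap.charpoly_toMatrix T e, hM, Matrix.charpoly_fin_two]
    simp [Matrix.trace_fin_two, Matrix.det_fin_two]
    ring
  ext z
  rw [complexEigenvalues, Set.mem_ofPred_eq, hpoly]
  simp [sub_eq_zero]

section Triangular

variable {F : Plane → Plane} {p : Plane} {J : Plane →L[ℝ] Plane}
  (e : OrthonormalBasis (Fin 2) ℝ Plane) {a l m : ℝ}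

theorem isDegenerateEquilibrium_of_triangular (hF : F p = 0) (hJ : HasFDerivAt F J p)
    (h0 : J (e 0) = (0 : ℝ) • e 0) (h1 : J (e 1) = l • e 0 + a • e 1) :
    IsDegenerateEquilibrium F p := by
  refine ⟨hF, J, hJ, 0, ?_, rfl⟩
  rw [complexEigenvalues_eq_of_triangular e.toBasis (T := (J : Plane →ₗ[ℝ] Plane)) (a := 0)
    (b := l) (d := a) (by simpa using h0) (by simpa using h1)]
  simp

theorem isSaddlePoint_of_triangular (hF : F p = 0) (hJ : HasFDerivAt F J p)
    (hm : 0 < m) (ha : a < 0)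
    (h0 : J (e 0) = m • e 0) (h1 : J (e 1) = l • e 0 + a • e 1) : IsSaddlePoint F p := by
  refine ⟨hF, J, hJ, ?_⟩
  rw [complexEigenvalues_eq_of_triangular e.toBasis (T := (J : Plane →ₗ[ℝ] Plane)) (a := m)
    (b := l) (d := a) (by simpa using h0) (by simpa using h1)]
  refine ⟨?_, ⟨a, by simp, by simpa using ha⟩, ⟨m, by simp, by simpa using hm⟩⟩
  rintro z (rfl | rfl)
  · simpa using hm.ne'
  · simpa using ha.ne

/-- Stretching the second coordinate by a large s makes the coupling term `l` relatively small, so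
that the squared norm of the stretched vector is a strict Lyapunov function. -/
theorem isAsymptoticallyStable_of_triangular (hF : F p = 0) (hJ : HasFDerivAt F J p)
    (hm : m < 0) (ha : a < 0)
    (h0 : J (e 0) = m • e 0) (h1 : J (e 1) = l • e 0 + a • e 1) :
    IsAsymptoticallyStable F p := by
  obtain ⟨s, hs1, hs⟩ : ∃ s : ℝ, 1 ≤ s ∧ l ^ 2 ≤ a * m * s ^ 2 := by
    have ham : 0 < a * m := mul_pos_of_neg_of_neg ha hm
    -- For X ≥ 0, the choice s = 1 + X gives both s ≥ 1, whence ‖d‖ ≤ ‖L d‖, and s² ≥ X.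
    refine ⟨1 + l ^ 2 / (a * m), by simp; positivity, ?_⟩
    have h2 : 0 ≤ l ^ 2 / (a * m) := by positivity
    calc l ^ 2 = a * m * (l ^ 2 / (a * m)) := (mul_div_cancel₀ _ ham.ne').symm
      _ ≤ a * m * (1 + l ^ 2 / (a * m)) ^ 2 := by
          gcongr
          nlinarith
  let L : Plane →L[ℝ] Plane := (innerSL ℝ (e 0)).smulRight (e 0) +
    (s • innerSL ℝ (e 1)).smulRight (e 1)
  have hLd : ∀ d, L d = inner ℝ (e 0) d • e 0 + (s * inner ℝ (e 1) d) • e 1 := fun d => rfl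
  have hd : ∀ d : Plane, d = inner ℝ (e 0) d • e 0 + inner ℝ (e 1) d • e 1 := fun d => by
    simpa using (e.sum_repr' d).symm
  have h01 : inner ℝ (e 0) (e 1) = (0 : ℝ) := e.orthonormal.2 (by decide)
  have h10 : inner ℝ (e 1) (e 0) = (0 : ℝ) := e.orthonormal.2 (by decide)
  refine isAsymptoticallyStable_of_inner_le (L := L) (c := min (-a) (-m) / 2) (K := 1) hF hJ
    (by simp [ha, hm]) one_pos (fun d => ?_) (fun d => ?_)
  · rw [one_mul, hLd]
    refine le_of_sq_le_sq ?_ (norm_nonneg _)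
    conv_lhs => rw [hd d]
    rw [norm_sq_smul_add_smul, norm_sq_smul_add_smul]
    have hs2 : 0 ≤ s ^ 2 - 1 := by nlinarith
    nlinarith [mul_nonneg hs2 (sq_nonneg (inner ℝ (e 1) d))]
  · have hJd : J d = (m * inner ℝ (e 0) d + l * inner ℝ (e 1) d) • e 0 +
        (a * inner ℝ (e 1) d) • e 1 := by
      conv_lhs => rw [hd d]
      rw [map_add, map_smul, map_smul, h0, h1]
      module
    have hJ0 : inner ℝ (e 0) (J d) = m * inner ℝ (e 0) d + l * inner ℝ (e 1) d := by
      rw [hJd]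
      simp [inner_add_right, real_inner_smul_right, h01]
    have hJ1 : inner ℝ (e 1) (J d) = a * inner ℝ (e 1) d := by
      rw [hJd]
      simp [inner_add_right, real_inner_smul_right, h10]
    rw [hLd d, hLd (J d), inner_smul_add_smul, norm_sq_smul_add_smul, hJ0, hJ1]
    generalize inner ℝ (e 0) d = x
    generalize inner ℝ (e 1) d = y
    have h2 : min (-a) (-m) / 2 * (x ^ 2 + (s * y) ^ 2) ≤
        (-m) / 2 * x ^ 2 + (-a) / 2 * (s * y) ^ 2 := by
      nlinarith [min_le_left (-a) (-m), min_le_right (-a) (-m), sq_nonneg x, sq_nonneg (s * y)]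
    have h3 : l * x * y ≤ (-m) / 2 * x ^ 2 + (-a) / 2 * (s * y) ^ 2 := by
      -- Multiplied by -m, the difference is half of (mx + ly)² + (a m s² - l²)y².
      have h4 : 0 ≤ -m * ((-m) / 2 * x ^ 2 + (-a) / 2 * (s * y) ^ 2 - l * x * y) := by
        nlinarith [sq_nonneg (m * x + l * y), mul_nonneg (sub_nonneg.2 hs) (sq_nonneg y)]
      have := nonneg_of_mul_nonneg_right h4 (by linarith)
      linarith
    nlinarith

end Triangular

/-! ### The filtered system when `G = Bᵀ B` -/

namespace FilterData

variable {S : FilterData}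

theorem gradient_h (S : FilterData) (x : Plane) : gradient S.h x = (2 : ℝ) • (x - S.xc) := by
  have hd : HasFDerivAt S.h _ x := ((hasFDerivAt_id x).sub_const S.xc).norm_sq.sub_const (S.r ^ 2)
  refine HasGradientAt.gradient (hasGradientAt_iff_hasFDerivAt.2 (hd.congr_fderiv ?_))
  ext d
  simp [two_smul]

/-- B (BᵀB)⁻¹ Bᵀ = 1 for invertible `B`; this is where full actuation and the choice of weight
remove the input matrix from the problem. -/
theorem map_inv_weight_inputGradient (hB : IsUnit S.B.det)
    (hG : ∀ x, S.G x = S.B.transpose * S.B) (x : Plane) :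
    S.B.toEuclideanLin ((S.G x)⁻¹.toEuclideanLin (S.inputGradient x)) = gradient S.h x := by
  have hBt : IsUnit S.B.transpose.det := by rwa [Matrix.det_transpose]
  have h : S.B * (S.G x)⁻¹ * S.B.transpose = 1 := by
    rw [hG, Matrix.mul_inv_rev, Matrix.mul_assoc, Matrix.mul_assoc, Matrix.nonsing_inv_mul _ hBt, Matrix.mul_one,
      Matrix.mul_nonsing_inv _ hB]
  rw [inputGradient, Matrix.toLpLin_apply, Matrix.toLpLin_apply, Matrix.toLpLin_apply,
    Matrix.mulVec_mulVec, Matrix.mulVec_mulVec, h, Matrix.one_mulVec]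

theorem inner_inputGradient_inv_weight (hB : IsUnit S.B.det)
    (hG : ∀ x, S.G x = S.B.transpose * S.B) (x : Plane) :
    inner ℝ (S.inputGradient x) ((S.G x)⁻¹.toEuclideanLin (S.inputGradient x)) =
      ‖gradient S.h x‖ ^ 2 := by
  have hadj : ∀ θ : Plane, inner ℝ (S.inputGradient x) θ =
      inner ℝ (gradient S.h x) (S.B.toEuclideanLin θ) := by
    intro θ
    have h1 := Matrix.toEuclideanLin_conjTranspose_eq_adjoint S.B
    rw [Matrix.conjTranspose_eq_transpose_of_trivial] at h1
    rw [inputGradient, h1, LinearMap.adjoint_inner_left]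
  rw [hadj, map_inv_weight_inputGradient hB hG, real_inner_self_eq_norm_sq]

theorem closedLoop_of_eta_neg (hB : IsUnit S.B.det) (hG : ∀ x, S.G x = S.B.transpose * S.B)
    {x : Plane} (hx : S.eta x < 0) :
    S.closedLoop x = S.Atilde.toEuclideanLin x -
      (S.eta x / (2 * ‖x - S.xc‖ ^ 2)) • (x - S.xc) := by
  rw [closedLoop, safetyFilter, if_neg (not_le.2 hx), map_smul,
    inner_inputGradient_inv_weight hB hG, map_inv_weight_inputGradient hB hG, gradient_h,
    norm_smul, smul_smul, sub_eq_add_neg _ ((_ : ℝ) • _), ← neg_smul, mul_pow]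
  congr 2
  rw [Real.norm_ofNat]
  ring

theorem solvesEquilibriumCondition_iff (hB : IsUnit S.B.det)
    (hG : ∀ x, S.G x = S.B.transpose * S.B) {x : Plane} {δ : ℝ} :
    S.SolvesEquilibriumCondition x δ ↔
      S.h x = 0 ∧ S.Atilde.toEuclideanLin x = (2 * δ) • (x - S.xc) := by
  rw [SolvesEquilibriumCondition, map_inv_weight_inputGradient hB hG, gradient_h, smul_smul,
    mul_comm δ 2]

theorem eta_eq (S : FilterData) (x : Plane) :
    S.eta x = 2 * inner ℝ (x - S.xc) (S.Atilde.toEuclideanLin x) +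
      S.α (‖x - S.xc‖ ^ 2 - S.r ^ 2) := by
  rw [eta, gradient_h, real_inner_smul_left, h]

/-- The linearization of the filtered system at an undesired equilibrium. -/
theorem exists_hasFDerivAt_closedLoop (hB : IsUnit S.B.det)
    (hG : ∀ x, S.G x = S.B.transpose * S.B) (hα0 : S.α 0 = 0) (hα : DifferentiableAt ℝ S.α 0)
    (hr : 0 < S.r) {p : Plane} {t : ℝ} (ht : t < 0) (hp : S.h p = 0)
    (hAp : S.Atilde.toEuclideanLin p = t • (p - S.xc)) :
    S.closedLoop p = 0 ∧ ∃ J : Plane →L[ℝ] Plane, HasFDerivAt S.closedLoop J p ∧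
      ∀ d, J d = S.Atilde.toEuclideanLin d - t • d -
        ((inner ℝ (p - S.xc) (S.Atilde.toEuclideanLin d - t • d) +
          deriv S.α 0 * inner ℝ (p - S.xc) d) / S.r ^ 2) • (p - S.xc) := by
  have hy : ‖p - S.xc‖ ^ 2 = S.r ^ 2 := sub_eq_zero.1 hp
  have heta : S.eta p = 2 * t * S.r ^ 2 := by
    rw [eta_eq, hAp, real_inner_smul_right, real_inner_self_eq_norm_sq, hy, sub_self, hα0]
    ring
  have hneg : S.eta p < 0 := by
    rw [heta]
    have := pow_pos hr 2
    nlinarith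
  set A : Plane →L[ℝ] Plane := S.Atilde.toEuclideanLin.toContinuousLinearMap with hA
  have hAd : ∀ d, S.Atilde.toEuclideanLin d = A d := fun d => rfl
  have hsub : HasFDerivAt (fun x : Plane => x - S.xc) (ContinuousLinearMap.id ℝ Plane) p :=
    (hasFDerivAt_id p).sub_const S.xc
  have hN := hsub.norm_sq
  have hα' : HasDerivAt S.α (deriv S.α 0) (‖p - S.xc‖ ^ 2 - S.r ^ 2) := by
    rw [hy, sub_self]
    exact hα.hasDerivAt
  have hη := ((hsub.inner ℝ A.hasFDerivAt).const_mul 2).add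
    (hα'.comp_hasFDerivAt p (hN.sub_const (S.r ^ 2)))
  have hηeq : S.eta = fun x => 2 * inner ℝ (x - S.xc) (A x) +
      S.α (‖x - S.xc‖ ^ 2 - S.r ^ 2) := funext fun x => eta_eq S x
  have hη' := hη.congr_of_eventuallyEq (f₁ := S.eta) (Filter.Eventually.of_forall fun x => by
    rw [hηeq]; rfl)
  -- As η(p) = 2tr² < 0 and η is continuous at p, the filter is active in a whole neighbourhood, and
  -- the case distinction disappears.
  have hev : S.closedLoop =ᶠ[nhds p] fun x =>
      A x - (S.eta x * (2 * ‖x - S.xc‖ ^ 2)⁻¹) • (x - S.xc) := by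
    filter_upwards [hη'.continuousAt.eventually_lt_const hneg] with x hx
    exact closedLoop_of_eta_neg hB hG hx
  have hr2 : S.r ^ 2 ≠ 0 := by positivity
  have h2N : 2 * ‖p - S.xc‖ ^ 2 ≠ 0 := by
    rw [hy]
    simpa using hr.ne'
  refine ⟨?_, _, (A.hasFDerivAt.sub ((hη'.mul ((hasDerivAt_inv h2N).comp_hasFDerivAt p (hN.const_mul 2))).smul hsub)).congr_of_eventuallyEq
    hev, fun d => ?_⟩
  · rw [hev.eq_of_nhds, ← hAd, hAp, heta, hy]
    simp only [sub_eq_zero]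
    congr 1
    field_simp
  · simp [fderivInnerCLM_apply, hy, heta, hAd]

    have h1 : 2 * t * S.r ^ 2 * ((S.r ^ 2)⁻¹ * 2⁻¹) = t := by field_simp
    rw [← inner_sub_left, ← hAd p, hAp, real_inner_smul_right, real_inner_comm _ d,
      inner_sub_right, real_inner_smul_right, sub_sub, h1]
    congr 3
    field_simp
    ring

end FilterData

/-! ### Frames adapted to the obstacle -/

theorem exists_orthonormalBasis_head {u : Plane} (hu : ‖u‖ = 1) :
    ∃ e : OrthonormalBasis (Fin 2) ℝ Plane, e 0 = u := by
  have hv : Orthonormal ℝ (Set.domRestrict ({0} : Set (Fin 2)) fun _ => u) :=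
    ⟨fun _ => hu, fun i j hij => (hij (Subsingleton.elim i j)).elim⟩
  obtain ⟨e, he⟩ := hv.exists_orthonormalBasis_extension_of_card_eq (by simp)
  exact ⟨e, he 0 rfl⟩

theorem exists_orthonormalBasis_pair {u w : Plane} (hu : ‖u‖ = 1) (hw : ‖w‖ = 1)
    (huw : inner ℝ u w = (0 : ℝ)) :
    ∃ e : OrthonormalBasis (Fin 2) ℝ Plane, e 0 = u ∧ e 1 = w := by
  have hwu : inner ℝ w u = (0 : ℝ) := by rw [real_inner_comm, huw]
  have hv : Orthonormal ℝ (Set.domRestrict Set.univ ![u, w]) := by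
    refine ⟨fun ⟨i, _⟩ => ?_, fun ⟨i, _⟩ ⟨j, _⟩ hij => ?_⟩
    · fin_cases i <;> simp [hu, hw]
    · fin_cases i <;> fin_cases j <;> simp_all
  obtain ⟨e, he⟩ := hv.exists_orthonormalBasis_extension_of_card_eq (by simp)
  exact ⟨e, he 0 trivial, he 1 trivial⟩


/-- The standing assumptions, in an orthonormal frame `e` whose first vector points to the center
of the obstacle. The matrix `Ã` is upper triangular in such a frame. -/
structure FilterData.IsAdaptedFrame (S : FilterData) (e : OrthonormalBasis (Fin 2) ℝ Plane)
    (c lam mu b : ℝ) : Prop where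
  isUnit_det : IsUnit S.B.det
  weight_eq : ∀ x, S.G x = S.B.transpose * S.B
  map_zero : S.α 0 = 0
  differentiableAt : DifferentiableAt ℝ S.α 0
  deriv_pos : 0 < deriv S.α 0
  radius_pos : 0 < S.r
  radius_lt : S.r < c
  lam_neg : lam < 0
  mu_neg : mu < 0
  center_eq : S.xc = c • e 0
  map_fst : S.Atilde.toEuclideanLin (e 0) = lam • e 0
  map_snd : S.Atilde.toEuclideanLin (e 1) = b • e 0 + mu • e 1

/-- The point with coordinates `y₁`, `y₂` relative to the center of the obstacle. -/
def FilterData.framePoint (S : FilterData) (e : OrthonormalBasis (Fin 2) ℝ Plane) (y₁ y₂ : ℝ) :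
    Plane := S.xc + (y₁ • e 0 + y₂ • e 1)

namespace FilterData

variable {S : FilterData} {e : OrthonormalBasis (Fin 2) ℝ Plane} {c lam mu b : ℝ}

theorem framePoint_inj {y₁ y₂ z₁ z₂ : ℝ} :
    S.framePoint e y₁ y₂ = S.framePoint e z₁ z₂ ↔ y₁ = z₁ ∧ y₂ = z₂ := by
  rw [framePoint, framePoint, add_right_inj, smul_add_smul_inj]

theorem exists_eq_framePoint (S : FilterData) (e : OrthonormalBasis (Fin 2) ℝ Plane) (x : Plane) :
    ∃ y₁ y₂, x = S.framePoint e y₁ y₂ := by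
  obtain ⟨a, b, h⟩ := exists_eq_smul_add_smul e (x - S.xc)
  exact ⟨a, b, by rw [framePoint, ← h, add_sub_cancel]⟩

namespace IsAdaptedFrame

theorem map_smul_add_smul (H : S.IsAdaptedFrame e c lam mu b) (x y : ℝ) :
    S.Atilde.toEuclideanLin (x • e 0 + y • e 1) = (lam * x + b * y) • e 0 + (mu * y) • e 1 := by
  rw [map_add, map_smul, map_smul, H.map_fst, H.map_snd]
  module

theorem solves_iff (H : S.IsAdaptedFrame e c lam mu b) {y₁ y₂ δ : ℝ} :
    S.SolvesEquilibriumCondition (S.framePoint e y₁ y₂) δ ↔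
      y₁ ^ 2 + y₂ ^ 2 = S.r ^ 2 ∧ (lam - 2 * δ) * y₁ + b * y₂ = -lam * c ∧
        (mu - 2 * δ) * y₂ = 0 := by
  have h1 : S.framePoint e y₁ y₂ = (c + y₁) • e 0 + y₂ • e 1 := by
    rw [framePoint, H.center_eq]
    module
  rw [solvesEquilibriumCondition_iff H.isUnit_det H.weight_eq, h, ← norm_sq_smul_add_smul e,
    sub_eq_zero]
  have h2 : S.framePoint e y₁ y₂ - S.xc = y₁ • e 0 + y₂ • e 1 := add_sub_cancel_left _ _
  rw [h2, h1, H.map_smul_add_smul, smul_add, smul_smul, smul_smul, smul_add_smul_inj]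
  refine and_congr_right fun _ => and_congr ⟨fun h => ?_, fun h => ?_⟩
    ⟨fun h => ?_, fun h => ?_⟩ <;> linarith

/-- Triangular form of the linearization at an undesired equilibrium. -/
theorem exists_linearization (H : S.IsAdaptedFrame e c lam mu b) {y₁ y₂ δ m : ℝ} (hδ : δ < 0)
    (hy : S.SolvesEquilibriumCondition (S.framePoint e y₁ y₂) δ)
    (hm : m * S.r ^ 2 = (lam - 2 * δ) * y₂ ^ 2 - b * y₁ * y₂ + (mu - 2 * δ) * y₁ ^ 2) :
    S.closedLoop (S.framePoint e y₁ y₂) = 0 ∧ ∃ (J : Plane →L[ℝ] Plane)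
      (f : OrthonormalBasis (Fin 2) ℝ Plane) (l : ℝ),
      HasFDerivAt S.closedLoop J (S.framePoint e y₁ y₂) ∧ J (f 0) = m • f 0 ∧
        J (f 1) = l • f 0 + (-deriv S.α 0) • f 1 := by
  have hr := H.radius_pos
  have hr0 : S.r ≠ 0 := hr.ne'
  obtain ⟨hcirc, hline, hsnd⟩ := H.solves_iff.1 hy
  obtain ⟨hh, hAp⟩ := (solvesEquilibriumCondition_iff H.isUnit_det H.weight_eq).1 hy
  obtain ⟨h0, J, hJ, hJd⟩ := exists_hasFDerivAt_closedLoop H.isUnit_det H.weight_eq H.map_zero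
    H.differentiableAt hr (by linarith : 2 * δ < 0) hh hAp
  have hp : S.framePoint e y₁ y₂ - S.xc = y₁ • e 0 + y₂ • e 1 := add_sub_cancel_left _ _
  have hunit : ∀ a b : ℝ, a ^ 2 + b ^ 2 = S.r ^ 2 →
      ‖(a / S.r) • e 0 + (b / S.r) • e 1‖ = 1 := by
    intro a b hab
    have h1 := norm_sq_smul_add_smul e (a / S.r) (b / S.r)
    rw [div_pow, div_pow, ← add_div, hab, div_self (by positivity)] at h1
    exact (pow_eq_one_iff_of_nonneg (norm_nonneg _) two_ne_zero).1 h1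
  -- `f 0` is the unit tangent of the circle at the equilibrium and `f 1` the outward unit normal.
  obtain ⟨f, hf0, hf1⟩ := exists_orthonormalBasis_pair (hunit (-y₂) y₁ (by linarith))
    (hunit y₁ y₂ hcirc) (by rw [inner_smul_add_smul]; ring)
  have hJc : ∀ x y : ℝ, J (x • e 0 + y • e 1) =
      ((lam - 2 * δ) * x + b * y - ((y₁ * ((lam - 2 * δ) * x + b * y) + y₂ * ((mu - 2 * δ) * y) +
        deriv S.α 0 * (y₁ * x + y₂ * y)) / S.r ^ 2) * y₁) • e 0 +
      ((mu - 2 * δ) * y - ((y₁ * ((lam - 2 * δ) * x + b * y) + y₂ * ((mu - 2 * δ) * y) +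
        deriv S.α 0 * (y₁ * x + y₂ * y)) / S.r ^ 2) * y₂) • e 1 := by
    intro x y
    have h1 : (lam * x + b * y) • e 0 + (mu * y) • e 1 - (2 * δ) • (x • e 0 + y • e 1) =
        ((lam - 2 * δ) * x + b * y) • e 0 + ((mu - 2 * δ) * y) • e 1 := by module
    rw [hJd, hp, H.map_smul_add_smul, h1, inner_smul_add_smul, inner_smul_add_smul]
    module
  -- By the equilibrium equations Ã - 2δ sends y to (-lam c) e₀; the off-diagonal entry is the
  -- tangential component of this vector divided by r.
  refine ⟨h0, J, f, -(-lam * c) * y₂ / S.r ^ 2, hJ, ?_, ?_⟩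
  · rw [hf0, hJc, smul_add, smul_smul, smul_smul, smul_add_smul_inj]
    constructor
    · field_simp
      rw [show S.r ^ 2 = y₁ ^ 2 + y₂ ^ 2 from hcirc.symm] at hm ⊢
      linear_combination y₂ * hm
    · field_simp
      rw [show S.r ^ 2 = y₁ ^ 2 + y₂ ^ 2 from hcirc.symm] at hm ⊢
      linear_combination (-y₁) * hm
  · rw [hf0, hf1, hJc, ← hline, smul_add, smul_add, smul_smul, smul_smul, smul_smul, smul_smul,
      add_add_add_comm, ← add_smul, ← add_smul, smul_add_smul_inj]
    constructor
    · field_simp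
      rw [show S.r ^ 2 = y₁ ^ 2 + y₂ ^ 2 from hcirc.symm]
      linear_combination (-y₁ * y₂) * hsnd
    · field_simp
      rw [show S.r ^ 2 = y₁ ^ 2 + y₂ ^ 2 from hcirc.symm]
      linear_combination y₁ ^ 2 * hsnd

theorem isDegenerateEquilibrium (H : S.IsAdaptedFrame e c lam mu b) {y₁ y₂ δ : ℝ} (hδ : δ < 0)
    (hy : S.SolvesEquilibriumCondition (S.framePoint e y₁ y₂) δ)
    (hm : (lam - 2 * δ) * y₂ ^ 2 - b * y₁ * y₂ + (mu - 2 * δ) * y₁ ^ 2 = 0) :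
    IsDegenerateEquilibrium S.closedLoop (S.framePoint e y₁ y₂) := by
  obtain ⟨h0, J, f, l, hJ, hf0, hf1⟩ := H.exists_linearization hδ hy (m := 0) (by linarith)
  exact isDegenerateEquilibrium_of_triangular f h0 hJ hf0 hf1

theorem isSaddlePoint (H : S.IsAdaptedFrame e c lam mu b) {y₁ y₂ δ : ℝ} (hδ : δ < 0)
    (hy : S.SolvesEquilibriumCondition (S.framePoint e y₁ y₂) δ)
    (hm : 0 < (lam - 2 * δ) * y₂ ^ 2 - b * y₁ * y₂ + (mu - 2 * δ) * y₁ ^ 2) :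
    IsSaddlePoint S.closedLoop (S.framePoint e y₁ y₂) := by
  have hr := H.radius_pos
  obtain ⟨h0, J, f, l, hJ, hf0, hf1⟩ := H.exists_linearization hδ hy
    (div_mul_cancel₀ _ (by positivity))
  exact isSaddlePoint_of_triangular f h0 hJ (div_pos hm (by positivity))
    (neg_lt_zero.2 H.deriv_pos) hf0 hf1

theorem isAsymptoticallyStable (H : S.IsAdaptedFrame e c lam mu b) {y₁ y₂ δ : ℝ} (hδ : δ < 0)
    (hy : S.SolvesEquilibriumCondition (S.framePoint e y₁ y₂) δ)
    (hm : (lam - 2 * δ) * y₂ ^ 2 - b * y₁ * y₂ + (mu - 2 * δ) * y₁ ^ 2 < 0) :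
    IsAsymptoticallyStable S.closedLoop (S.framePoint e y₁ y₂) := by
  have hr := H.radius_pos
  obtain ⟨h0, J, f, l, hJ, hf0, hf1⟩ := H.exists_linearization hδ hy
    (div_mul_cancel₀ _ (by positivity))
  exact isAsymptoticallyStable_of_triangular f h0 hJ (div_neg_of_neg_of_pos hm (by positivity))
    (neg_lt_zero.2 H.deriv_pos) hf0 hf1

end IsAdaptedFrame

end FilterData

/-- The intersection of a line with a circle. -/
theorem line_circle_iff {u v k r σ y₁ y₂ : ℝ} (hN : 0 < u ^ 2 + v ^ 2)
    (hσ : σ ^ 2 = (u ^ 2 + v ^ 2) * r ^ 2 - k ^ 2) :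
    (y₁ ^ 2 + y₂ ^ 2 = r ^ 2 ∧ u * y₁ + v * y₂ = k) ↔
      (y₁ = (k * u - v * σ) / (u ^ 2 + v ^ 2) ∧ y₂ = (k * v + u * σ) / (u ^ 2 + v ^ 2)) ∨
      (y₁ = (k * u - v * -σ) / (u ^ 2 + v ^ 2) ∧ y₂ = (k * v + u * -σ) / (u ^ 2 + v ^ 2)) := by
  constructor
  · rintro ⟨hc, hl⟩
    -- Lagrange's identity: (u y₁ + v y₂)² + (u y₂ - v y₁)² = (u² + v²)(y₁² + y₂²). The line fixes
    -- one component of y and the circle fixes the other up to sign.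
    have h1 : (u * y₂ - v * y₁) ^ 2 = σ ^ 2 := by
      rw [hσ, ← hc, ← hl]
      ring
    simp only [eq_div_iff hN.ne']
    rcases sq_eq_sq_iff_eq_or_eq_neg.1 h1 with h | h
    · left
      rw [← h, ← hl]
      constructor <;> ring
    · right
      rw [← h, ← hl]
      constructor <;> ring
  · rintro (⟨rfl, rfl⟩ | ⟨rfl, rfl⟩)
    all_goals
      constructor
      · field_simp
        linear_combination (u ^ 2 + v ^ 2) * hσ
      · field_simp
        ring

/-! ### Undesired equilibria as axis point and line-circle intersections -/

namespace FilterData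

variable {S : FilterData} {e : OrthonormalBasis (Fin 2) ℝ Plane} {c lam mu b : ℝ}

namespace IsAdaptedFrame

theorem solves_axis (H : S.IsAdaptedFrame e c lam mu b) :
    S.SolvesEquilibriumCondition (S.framePoint e S.r 0) ((lam + lam * c / S.r) / 2) := by
  have hr := H.radius_pos
  refine H.solves_iff.2 ⟨by ring, ?_, by ring⟩
  field_simp
  ring

theorem axis_multiplier_neg (H : S.IsAdaptedFrame e c lam mu b) :
    (lam + lam * c / S.r) / 2 < 0 := by
  have hr := H.radius_pos
  have hlam := H.lam_neg
  have hc := H.radius_lt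
  have : lam * c / S.r < 0 := div_neg_of_neg_of_pos (by nlinarith) hr
  linarith

/-- The equation (mu - 2δ)y₂ = 0 splits the solutions. On the axis, y₁ = -r would give 2δr = lam(r -
c) > 0. Off the axis 2δ = mu, which is negative automatically. -/
theorem mem_undesiredEquilibria_iff (H : S.IsAdaptedFrame e c lam mu b) {y₁ y₂ : ℝ} :
    S.framePoint e y₁ y₂ ∈ S.undesiredEquilibria ↔ (y₁ = S.r ∧ y₂ = 0) ∨
      (y₂ ≠ 0 ∧ y₁ ^ 2 + y₂ ^ 2 = S.r ^ 2 ∧ (lam - mu) * y₁ + b * y₂ = -lam * c) := by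
  have hr := H.radius_pos
  have hc := H.radius_lt
  have hlam := H.lam_neg
  constructor
  · rintro ⟨δ, hδ, h⟩
    obtain ⟨h1, h2, h3⟩ := H.solves_iff.1 h
    by_cases hy : y₂ = 0
    · subst hy
      left
      refine ⟨?_, rfl⟩
      rcases sq_eq_sq_iff_eq_or_eq_neg.1 (show y₁ ^ 2 = S.r ^ 2 by linarith) with h | h
      · exact h
      · rw [h] at h2
        nlinarith
    · right
      have h4 : 2 * δ = mu := by
        have := (mul_eq_zero.1 h3).resolve_right hy
        linarith
      rw [h4] at h2
      exact ⟨hy, h1, h2⟩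
  · rintro (⟨rfl, rfl⟩ | ⟨hy, h1, h2⟩)
    · exact ⟨_, H.axis_multiplier_neg, H.solves_axis⟩
    · refine ⟨mu / 2, by linarith [H.mu_neg], H.solves_iff.2 ⟨h1, ?_, by ring⟩⟩
      rw [← h2]
      ring

/-- Dropping the sign condition on δ only readmits the far axis point, whose multiplier is (lam -
lam c / r)/2. -/
theorem potentialUndesiredEquilibria_eq (H : S.IsAdaptedFrame e c lam mu b) :
    S.potentialUndesiredEquilibria = insert (S.framePoint e (-S.r) 0) S.undesiredEquilibria := by
  have hr := H.radius_pos
  ext x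
  obtain ⟨y₁, y₂, rfl⟩ := S.exists_eq_framePoint e x
  rw [Set.mem_insert_iff, framePoint_inj, H.mem_undesiredEquilibria_iff]
  constructor
  · rintro ⟨δ, h⟩
    obtain ⟨h1, h2, h3⟩ := H.solves_iff.1 h
    by_cases hy : y₂ = 0
    · subst hy
      rcases sq_eq_sq_iff_eq_or_eq_neg.1 (show y₁ ^ 2 = S.r ^ 2 by linarith) with h | h <;> simp [h]
    · right; right
      have h4 : 2 * δ = mu := by
        have := (mul_eq_zero.1 h3).resolve_right hy
        linarith
      rw [h4] at h2
      exact ⟨hy, h1, h2⟩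
  · rintro (⟨rfl, rfl⟩ | h)
    · refine ⟨(lam - lam * c / S.r) / 2, H.solves_iff.2 ⟨by ring, ?_, by ring⟩⟩
      field_simp
      ring
    · obtain ⟨δ, -, h⟩ := H.mem_undesiredEquilibria_iff.2 h
      exact ⟨δ, h⟩

theorem ncard_potentialUndesiredEquilibria (H : S.IsAdaptedFrame e c lam mu b)
    (hfin : S.undesiredEquilibria.Finite) :
    S.potentialUndesiredEquilibria.ncard = S.undesiredEquilibria.ncard + 1 := by
  have hr := H.radius_pos
  rw [H.potentialUndesiredEquilibria_eq, Set.ncard_insert_of_notMem _ hfin]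
  rw [H.mem_undesiredEquilibria_iff]
  rintro (⟨h, -⟩ | ⟨h, -⟩)
  · linarith
  · exact h rfl

theorem ncard_of_eq_singleton (H : S.IsAdaptedFrame e c lam mu b) {p : Plane}
    (h : S.undesiredEquilibria = {p}) :
    S.potentialUndesiredEquilibria.ncard = 2 ∧ S.undesiredEquilibria.ncard = 1 := by
  rw [H.ncard_potentialUndesiredEquilibria (by rw [h]; exact Set.toFinite _), h]
  simp

theorem ncard_of_eq_pair (H : S.IsAdaptedFrame e c lam mu b) {p q : Plane} (hpq : p ≠ q)
    (h : S.undesiredEquilibria = {p, q}) :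
    S.potentialUndesiredEquilibria.ncard = 3 ∧ S.undesiredEquilibria.ncard = 2 := by
  rw [H.ncard_potentialUndesiredEquilibria (by rw [h]; exact Set.toFinite _), h,
    Set.ncard_pair hpq]
  simp

theorem ncard_of_eq_triple (H : S.IsAdaptedFrame e c lam mu b) {p q s : Plane} (hpq : p ≠ q)
    (hps : p ≠ s) (hqs : q ≠ s) (h : S.undesiredEquilibria = {p, q, s}) :
    S.potentialUndesiredEquilibria.ncard = 4 ∧ S.undesiredEquilibria.ncard = 3 := by
  rw [H.ncard_potentialUndesiredEquilibria (by rw [h]; exact Set.toFinite _), h,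
    Set.ncard_eq_three.2 ⟨p, q, s, hpq, hps, hqs, rfl⟩]
  simp

/-- This is r² times the tangential eigenvalue at the near axis point; its sign tells on which side
of the line that point lies. -/
theorem axis_transversal (H : S.IsAdaptedFrame e c lam mu b) :
    (lam - 2 * ((lam + lam * c / S.r) / 2)) * 0 ^ 2 - b * S.r * 0 +
      (mu - 2 * ((lam + lam * c / S.r) / 2)) * S.r ^ 2 =
      S.r * (-lam * c - (lam - mu) * S.r) := by
  have hr := H.radius_pos
  field_simp
  ring

theorem axis_isSaddlePoint (H : S.IsAdaptedFrame e c lam mu b)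
    (h : (lam - mu) * S.r < -lam * c) : IsSaddlePoint S.closedLoop (S.framePoint e S.r 0) := by
  refine H.isSaddlePoint H.axis_multiplier_neg H.solves_axis ?_
  rw [H.axis_transversal]
  exact mul_pos H.radius_pos (by linarith)

theorem axis_isDegenerateEquilibrium (H : S.IsAdaptedFrame e c lam mu b)
    (h : (lam - mu) * S.r = -lam * c) :
    IsDegenerateEquilibrium S.closedLoop (S.framePoint e S.r 0) := by
  refine H.isDegenerateEquilibrium H.axis_multiplier_neg H.solves_axis ?_
  rw [H.axis_transversal, h, sub_self, mul_zero]

theorem axis_isAsymptoticallyStable (H : S.IsAdaptedFrame e c lam mu b)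
    (h : -lam * c < (lam - mu) * S.r) :
    IsAsymptoticallyStable S.closedLoop (S.framePoint e S.r 0) := by
  refine H.isAsymptoticallyStable H.axis_multiplier_neg H.solves_axis ?_
  rw [H.axis_transversal]
  exact mul_neg_of_pos_of_neg H.radius_pos (by linarith)

section OffAxis

variable {y₁ y₂ : ℝ}

theorem solves_offAxis (H : S.IsAdaptedFrame e c lam mu b) (hc : y₁ ^ 2 + y₂ ^ 2 = S.r ^ 2)
    (hl : (lam - mu) * y₁ + b * y₂ = -lam * c) :
    S.SolvesEquilibriumCondition (S.framePoint e y₁ y₂) (mu / 2) := by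
  refine H.solves_iff.2 ⟨hc, ?_, by ring⟩
  rw [← hl]
  ring

theorem offAxis_isSaddlePoint (H : S.IsAdaptedFrame e c lam mu b)
    (hc : y₁ ^ 2 + y₂ ^ 2 = S.r ^ 2) (hl : (lam - mu) * y₁ + b * y₂ = -lam * c)
    (h : 0 < y₂ * ((lam - mu) * y₂ - b * y₁)) :
    IsSaddlePoint S.closedLoop (S.framePoint e y₁ y₂) :=
  H.isSaddlePoint (by linarith [H.mu_neg]) (H.solves_offAxis hc hl) (by linarith)

theorem offAxis_isDegenerateEquilibrium (H : S.IsAdaptedFrame e c lam mu b)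
    (hc : y₁ ^ 2 + y₂ ^ 2 = S.r ^ 2) (hl : (lam - mu) * y₁ + b * y₂ = -lam * c)
    (h : y₂ * ((lam - mu) * y₂ - b * y₁) = 0) :
    IsDegenerateEquilibrium S.closedLoop (S.framePoint e y₁ y₂) :=
  H.isDegenerateEquilibrium (by linarith [H.mu_neg]) (H.solves_offAxis hc hl) (by linarith)

theorem offAxis_isAsymptoticallyStable (H : S.IsAdaptedFrame e c lam mu b)
    (hc : y₁ ^ 2 + y₂ ^ 2 = S.r ^ 2) (hl : (lam - mu) * y₁ + b * y₂ = -lam * c)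
    (h : y₂ * ((lam - mu) * y₂ - b * y₁) < 0) :
    IsAsymptoticallyStable S.closedLoop (S.framePoint e y₁ y₂) :=
  H.isAsymptoticallyStable (by linarith [H.mu_neg]) (H.solves_offAxis hc hl) (by linarith)

end OffAxis

/-! ### The four configurations -/

/-- The difference of the two sides is -mu r - lam(c - r), a sum of positive terms. Hence (ur)² = k²
can only mean ur = k. -/
theorem neg_lt_mul_radius (H : S.IsAdaptedFrame e c lam mu b) :
    -(-lam * c) < (lam - mu) * S.r := by
  nlinarith [H.lam_neg, H.mu_neg, H.radius_pos, H.radius_lt,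
    mul_neg_of_neg_of_pos H.mu_neg H.radius_pos,
    mul_neg_of_neg_of_pos H.lam_neg (sub_pos.2 H.radius_lt)]

theorem gap_pos (H : S.IsAdaptedFrame e c lam mu b) : 0 < -lam * c :=
  mul_pos (neg_pos.2 H.lam_neg) (H.radius_pos.trans H.radius_lt)

theorem eq_singleton_of_forall (H : S.IsAdaptedFrame e c lam mu b)
    (h : ∀ y₁ y₂ : ℝ, y₁ ^ 2 + y₂ ^ 2 = S.r ^ 2 → (lam - mu) * y₁ + b * y₂ = -lam * c → y₂ = 0) :
    S.undesiredEquilibria = {S.framePoint e S.r 0} := by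
  ext x
  obtain ⟨y₁, y₂, rfl⟩ := S.exists_eq_framePoint e x
  rw [H.mem_undesiredEquilibria_iff, Set.mem_singleton_iff, framePoint_inj]
  exact or_iff_left fun ⟨h0, h1, h2⟩ => h0 (h y₁ y₂ h1 h2)

/-- The line misses the circle: a common point would violate the Cauchy-Schwarz inequality. Moreover
(ur)² ≤ (u² + b²)r² < k² gives ur < k. -/
theorem hasConfiguration_oneSaddle (H : S.IsAdaptedFrame e c lam mu b)
    (hD : ((lam - mu) ^ 2 + b ^ 2) * S.r ^ 2 < (-lam * c) ^ 2) :
    S.HasConfiguration .oneSaddle := by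
  have hE := H.eq_singleton_of_forall fun y₁ y₂ h1 h2 => by
    rw [← h1, ← h2] at hD
    nlinarith [sq_nonneg ((lam - mu) * y₂ - b * y₁)]
  refine ⟨(H.ncard_of_eq_singleton hE).1, (H.ncard_of_eq_singleton hE).2, _, hE,
    H.axis_isSaddlePoint ?_⟩
  refine lt_of_pow_lt_pow_left₀ 2 H.gap_pos.le ?_
  nlinarith [mul_nonneg (sq_nonneg b) (sq_nonneg S.r)]

/-- The line is the vertical tangent at (r, 0), so its only contact point is the axis equilibrium
itself. -/
theorem hasConfiguration_oneDegenerate (H : S.IsAdaptedFrame e c lam mu b)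
    (hu : (lam - mu) * S.r = -lam * c) (hb : b = 0) : S.HasConfiguration .oneDegenerate := by
  have hgap := H.gap_pos
  have hE := H.eq_singleton_of_forall fun y₁ y₂ h1 h2 => by
    have hne : lam - mu ≠ 0 := by
      rintro h
      rw [h, zero_mul] at hu
      linarith
    have h3 : y₁ = S.r := mul_left_cancel₀ hne (by rw [hu, ← h2, hb]; ring)
    rw [h3] at h1
    exact pow_eq_zero_iff two_ne_zero |>.1 (by linarith)
  exact ⟨(H.ncard_of_eq_singleton hE).1, (H.ncard_of_eq_singleton hE).2, _, hE,
    H.axis_isDegenerateEquilibrium hu⟩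

/-- The line touches the circle off the axis, because b ≠ 0. At the contact point u y₂ - b y₁ = 0,
so the tangential eigenvalue vanishes there. -/
theorem hasConfiguration_saddleAndDegenerate_of_tangent (H : S.IsAdaptedFrame e c lam mu b)
    (hD : ((lam - mu) ^ 2 + b ^ 2) * S.r ^ 2 = (-lam * c) ^ 2) (hb : b ≠ 0) :
    S.HasConfiguration .saddleAndDegenerate := by
  have hgap := H.gap_pos
  have hr := H.radius_pos
  have hb2 : 0 < b ^ 2 := by positivity
  have hN : 0 < (lam - mu) ^ 2 + b ^ 2 := by positivity
  have hiff := fun y₁ y₂ : ℝ => line_circle_iff (y₁ := y₁) (y₂ := y₂) (k := -lam * c) (r := S.r)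
    (σ := 0) hN (by rw [hD]; ring)
  set z₁ := (-lam * c * (lam - mu) - b * 0) / ((lam - mu) ^ 2 + b ^ 2) with hz₁
  set z₂ := (-lam * c * b + (lam - mu) * 0) / ((lam - mu) ^ 2 + b ^ 2) with hz₂
  obtain ⟨hc, hl⟩ := (hiff z₁ z₂).2 (Or.inl ⟨rfl, rfl⟩)
  have hz : z₂ ≠ 0 := by
    rw [hz₂, mul_zero, add_zero]
    exact div_ne_zero (mul_ne_zero hgap.ne' hb) hN.ne'
  have hE : S.undesiredEquilibria = {S.framePoint e S.r 0, S.framePoint e z₁ z₂} := by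
    ext x
    obtain ⟨y₁, y₂, rfl⟩ := S.exists_eq_framePoint e x
    rw [H.mem_undesiredEquilibria_iff, Set.mem_insert_iff, Set.mem_singleton_iff, framePoint_inj,
      framePoint_inj, hiff, neg_zero, or_self]
    refine or_congr_right (and_iff_right_of_imp ?_)
    rintro ⟨-, rfl⟩
    exact hz
  have hne : S.framePoint e S.r 0 ≠ S.framePoint e z₁ z₂ := fun h =>
    hz (framePoint_inj.1 h).2.symm
  refine ⟨(H.ncard_of_eq_pair hne hE).1, (H.ncard_of_eq_pair hne hE).2, _, _, hE,
    H.axis_isSaddlePoint ?_, H.offAxis_isDegenerateEquilibrium hc hl ?_⟩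
  · refine lt_of_pow_lt_pow_left₀ 2 hgap.le ?_
    nlinarith [mul_pos hb2 (pow_pos hr 2)]
  · rw [hz₁, hz₂]
    field_simp
    ring

/-- The line cuts the circle at (r, 0) and, being non-vertical, at a second point. The axis point is
now the degenerate one and the second intersection is the saddle. -/
theorem hasConfiguration_saddleAndDegenerate_of_axis (H : S.IsAdaptedFrame e c lam mu b)
    (hu : (lam - mu) * S.r = -lam * c) (hb : b ≠ 0) :
    S.HasConfiguration .saddleAndDegenerate := by
  have hgap := H.gap_pos
  have hr := H.radius_pos
  have hb2 : 0 < b ^ 2 := by positivity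
  have hN : 0 < (lam - mu) ^ 2 + b ^ 2 := by positivity
  -- With ur = k the discriminant is the square of br; the root -br gives y₂ = 0, that is, the axis
  -- point.
  have hiff := fun y₁ y₂ : ℝ => line_circle_iff (y₁ := y₁) (y₂ := y₂) (k := -lam * c) (r := S.r)
    (σ := b * S.r) hN (by rw [← hu]; ring)
  set z₁ := (-lam * c * (lam - mu) - b * (b * S.r)) / ((lam - mu) ^ 2 + b ^ 2) with hz₁
  set z₂ := (-lam * c * b + (lam - mu) * (b * S.r)) / ((lam - mu) ^ 2 + b ^ 2) with hz₂
  obtain ⟨hc, hl⟩ := (hiff z₁ z₂).2 (Or.inl ⟨rfl, rfl⟩)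
  have hz₂' : z₂ = 2 * (-lam * c) * b / ((lam - mu) ^ 2 + b ^ 2) := by
    rw [hz₂, ← hu]
    ring
  have hw : (lam - mu) * z₂ - b * z₁ = b * S.r := by
    rw [hz₁, hz₂]
    field_simp
    ring
  have hz : z₂ ≠ 0 := by
    rw [hz₂']
    exact div_ne_zero (mul_ne_zero (mul_ne_zero two_ne_zero hgap.ne') hb) hN.ne'
  have hE : S.undesiredEquilibria = {S.framePoint e z₁ z₂, S.framePoint e S.r 0} := by
    ext x
    obtain ⟨y₁, y₂, rfl⟩ := S.exists_eq_framePoint e x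
    rw [H.mem_undesiredEquilibria_iff, Set.mem_insert_iff, Set.mem_singleton_iff, framePoint_inj,
      framePoint_inj, hiff, or_comm]
    refine or_congr_left ⟨?_, ?_⟩
    · rintro ⟨h0, h | ⟨-, h⟩⟩
      · exact h
      · refine (h0 ?_).elim
        rw [h, ← hu]
        ring
    · rintro ⟨rfl, rfl⟩
      exact ⟨hz, Or.inl ⟨rfl, rfl⟩⟩
  have hne : S.framePoint e z₁ z₂ ≠ S.framePoint e S.r 0 := fun h => hz (framePoint_inj.1 h).2
  refine ⟨(H.ncard_of_eq_pair hne hE).1, (H.ncard_of_eq_pair hne hE).2, _, _, hE,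
    H.offAxis_isSaddlePoint hc hl ?_, H.axis_isDegenerateEquilibrium hu⟩
  rw [hw, hz₂']
  have : 2 * (-lam * c) * b / ((lam - mu) ^ 2 + b ^ 2) * (b * S.r) =
      2 * (-lam * c) * S.r * b ^ 2 / ((lam - mu) ^ 2 + b ^ 2) := by ring
  rw [this]
  positivity

/-- The line is a secant avoiding (r, 0). The tangential eigenvalues at its two points z and w have
the signs of z₂σ and -w₂σ, and z₂w₂ has the sign of k² - (ur)². Thus exactly one of the three
equilibria is stable: one of z, w if ur < k, and the axis point if ur > k. -/
theorem hasConfiguration_twoSaddlesAndStable (H : S.IsAdaptedFrame e c lam mu b)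
    (hD : (-lam * c) ^ 2 < ((lam - mu) ^ 2 + b ^ 2) * S.r ^ 2)
    (hu : (lam - mu) * S.r ≠ -lam * c) : S.HasConfiguration .twoSaddlesAndStable := by
  have hgap := H.gap_pos
  have hlow := H.neg_lt_mul_radius
  have hr := H.radius_pos
  have hN : 0 < (lam - mu) ^ 2 + b ^ 2 := by
    refine pos_of_mul_pos_left ?_ (sq_nonneg S.r)
    exact (pow_pos hgap 2).trans hD
  obtain ⟨σ, hσ0, hσ⟩ : ∃ σ : ℝ, 0 < σ ∧
      σ ^ 2 = ((lam - mu) ^ 2 + b ^ 2) * S.r ^ 2 - (-lam * c) ^ 2 :=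
    ⟨_, Real.sqrt_pos.2 (sub_pos.2 hD), Real.sq_sqrt (sub_pos.2 hD).le⟩
  have hiff := fun y₁ y₂ : ℝ => line_circle_iff (y₁ := y₁) (y₂ := y₂) hN hσ
  generalize hk : -lam * c = k at *
  generalize hv : lam - mu = u at *
  set N := u ^ 2 + b ^ 2 with hNdef
  set z₁ := (k * u - b * σ) / N with hz₁
  set z₂ := (k * b + u * σ) / N with hz₂
  set w₁ := (k * u - b * -σ) / N with hw₁
  set w₂ := (k * b + u * -σ) / N with hw₂
  obtain ⟨hzc, hzl⟩ := (hiff z₁ z₂).2 (Or.inl ⟨rfl, rfl⟩)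
  obtain ⟨hwc, hwl⟩ := (hiff w₁ w₂).2 (Or.inr ⟨rfl, rfl⟩)
  have hzw : u * z₂ - b * z₁ = σ := by
    rw [hz₁, hz₂]
    field_simp
    rw [hNdef]
    ring
  have hww : u * w₂ - b * w₁ = -σ := by
    rw [hw₁, hw₂]
    field_simp
    rw [hNdef]
    ring
  have hprod : z₂ * w₂ * N = k ^ 2 - (u * S.r) ^ 2 := by
    rw [hz₂, hw₂]
    field_simp
    rw [hNdef] at hσ ⊢
    linear_combination (-u ^ 2) * hσ
  have hdiff : (z₂ - w₂) * N = 2 * u * σ := by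
    rw [hz₂, hw₂]
    field_simp
    ring
  have hsq : (u * S.r) ^ 2 ≠ k ^ 2 := fun h => by
    rcases sq_eq_sq_iff_eq_or_eq_neg.1 h with h | h
    · exact hu h
    · linarith
  have hz : z₂ ≠ 0 := fun h => hsq (by rw [h] at hprod; linarith)
  have hw : w₂ ≠ 0 := fun h => hsq (by rw [h] at hprod; linarith)
  have hE : S.undesiredEquilibria =
      {S.framePoint e S.r 0, S.framePoint e z₁ z₂, S.framePoint e w₁ w₂} := by
    ext x
    obtain ⟨y₁, y₂, rfl⟩ := S.exists_eq_framePoint e x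
    rw [H.mem_undesiredEquilibria_iff, Set.mem_insert_iff, Set.mem_insert_iff,
      Set.mem_singleton_iff, framePoint_inj, framePoint_inj, framePoint_inj, hv, hk, hiff]
    refine or_congr_right (and_iff_right_of_imp ?_)
    rintro (⟨-, rfl⟩ | ⟨-, rfl⟩)
    · exact hz
    · exact hw
  have h1 : S.framePoint e S.r 0 ≠ S.framePoint e z₁ z₂ := fun h =>
    hz (framePoint_inj.1 h).2.symm
  have h2 : S.framePoint e S.r 0 ≠ S.framePoint e w₁ w₂ := fun h =>
    hw (framePoint_inj.1 h).2.symm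
  have h3 : S.framePoint e z₁ z₂ ≠ S.framePoint e w₁ w₂ := fun h => by
    obtain ⟨h4, h5⟩ := framePoint_inj.1 h
    rw [← h4, ← h5, hzw] at hww
    linarith
  refine ⟨(H.ncard_of_eq_triple h1 h2 h3 hE).1, (H.ncard_of_eq_triple h1 h2 h3 hE).2, ?_⟩
  rw [hE]
  rw [← hk, ← hv] at hzl hwl
  rcases lt_or_gt_of_ne hu with h | h
  · have hpos : 0 < z₂ * w₂ * N := by
      rw [hprod, sub_pos]
      exact sq_lt_sq' hlow h
    have hzw0 : 0 < z₂ * w₂ := pos_of_mul_pos_left hpos hN.le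
    have hax := H.axis_isSaddlePoint (by rw [hv, hk]; exact h)
    rcases pos_and_pos_or_neg_and_neg_of_mul_pos hzw0 with ⟨hz0, hw0⟩ | ⟨hz0, hw0⟩
    · refine ⟨S.framePoint e w₁ w₂, S.framePoint e S.r 0, S.framePoint e z₁ z₂, by grind,
        H.offAxis_isAsymptoticallyStable hwc hwl ?_, hax, H.offAxis_isSaddlePoint hzc hzl ?_⟩
      · rw [hv, hww]
        exact mul_neg_of_pos_of_neg hw0 (neg_neg_of_pos hσ0)
      · rw [hv, hzw]
        positivity
    · refine ⟨S.framePoint e z₁ z₂, S.framePoint e S.r 0, S.framePoint e w₁ w₂, by grind,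
        H.offAxis_isAsymptoticallyStable hzc hzl ?_, hax, H.offAxis_isSaddlePoint hwc hwl ?_⟩
      · rw [hv, hzw]
        exact mul_neg_of_neg_of_pos hz0 hσ0
      · rw [hv, hww]
        exact mul_pos_of_neg_of_neg hw0 (neg_neg_of_pos hσ0)
  -- Here z₂ and w₂ have opposite signs, and z₂ - w₂ = 2uσ/N > 0 decides which one is positive.
  · have hu0 : 0 < u := pos_of_mul_pos_left (hgap.trans h) hr.le
    have hneg : z₂ * w₂ * N < 0 := by
      rw [hprod, sub_neg]
      exact pow_lt_pow_left₀ h hgap.le two_ne_zero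
    have hzw0 : z₂ * w₂ < 0 := neg_of_mul_neg_left hneg hN.le
    have hlt : w₂ < z₂ := by
      have : 0 < (z₂ - w₂) * N := by
        rw [hdiff]
        positivity
      linarith [pos_of_mul_pos_left this hN.le]
    obtain ⟨hz0, hw0⟩ : 0 < z₂ ∧ w₂ < 0 :=
      (mul_neg_iff.1 hzw0).resolve_right fun h => by linarith [h.1, h.2]
    refine ⟨_, _, _, rfl, H.axis_isAsymptoticallyStable (by rw [hv, hk]; exact h),
      H.offAxis_isSaddlePoint hzc hzl ?_, H.offAxis_isSaddlePoint hwc hwl ?_⟩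
    · rw [hv, hzw]
      positivity
    · rw [hv, hww]
      exact mul_pos_of_neg_of_neg hw0 (neg_neg_of_pos hσ0)

theorem exists_hasConfiguration (H : S.IsAdaptedFrame e c lam mu b) :
    ∃ C, S.HasConfiguration C := by
  by_cases hu : (lam - mu) * S.r = -lam * c
  · by_cases hb : b = 0
    · exact ⟨_, H.hasConfiguration_oneDegenerate hu hb⟩
    · exact ⟨_, H.hasConfiguration_saddleAndDegenerate_of_axis hu hb⟩
  rcases lt_trichotomy (((lam - mu) ^ 2 + b ^ 2) * S.r ^ 2) ((-lam * c) ^ 2) with h | h | h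
  · exact ⟨_, H.hasConfiguration_oneSaddle h⟩
  -- Tangency with b = 0 would force ur = k or ur = -k; the first is excluded by `hu`, the second by
  -- `neg_lt_mul_radius`.
  · refine ⟨_, H.hasConfiguration_saddleAndDegenerate_of_tangent h ?_⟩
    rintro rfl
    rcases sq_eq_sq_iff_eq_or_eq_neg.1 (show ((lam - mu) * S.r) ^ 2 = (-lam * c) ^ 2 by
      linarith) with h | h
    · exact hu h
    · linarith [H.neg_lt_mul_radius]
  · exact ⟨_, H.hasConfiguration_twoSaddlesAndStable h hu⟩

end IsAdaptedFrame

end FilterData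

/-! ### Exclusivity of the configurations and existence of an adapted frame -/

theorem IsDegenerateEquilibrium.not_isSaddlePoint {F : Plane → Plane} {p : Plane}
    (h : IsDegenerateEquilibrium F p) : ¬ IsSaddlePoint F p := by
  rintro ⟨-, J', hJ', hne, -⟩
  obtain ⟨-, J, hJ, z, hz, hz0⟩ := h
  rw [hJ.unique hJ'] at hz
  exact hne z hz hz0

/-- The cardinality of E separates all labels except the two with a single undesired equilibrium;
these are separated by uniqueness of the derivative. -/
theorem FilterData.HasConfiguration.unique {S : FilterData} {C C' : EquilibriumConfiguration}
    (h : S.HasConfiguration C) (h' : S.HasConfiguration C') : C = C' := by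
  have key : S.HasConfiguration .oneDegenerate → ¬ S.HasConfiguration .oneSaddle := by
    rintro ⟨-, -, p, hp, hdeg⟩ ⟨-, -, q, hq, hsad⟩
    rw [hp, Set.singleton_eq_singleton_iff] at hq
    exact hdeg.not_isSaddlePoint (hq ▸ hsad)
  cases C <;> cases C' <;> first
    | rfl
    | exact (key h h').elim
    | exact (key h' h).elim
    | (have := h.1.symm.trans h'.1; simp at this)

/-- A frame adapted to the obstacle exists if its center is an eigenvector of `Ã`. -/
theorem FilterData.exists_isAdaptedFrame (S : FilterData) (hB : IsUnit S.B.det)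
    (hG : ∀ x, S.G x = S.B.transpose * S.B) (hα : IsExtendedClassKInfty S.α)
    (hα_diff : Differentiable ℝ S.α) (hα_pos : 0 < deriv S.α 0) (hr : 0 < S.r)
    (h_origin : 0 < S.h 0) (hA : IsHurwitz S.Atilde) {lam : ℝ}
    (hxc : Module.End.HasEigenvector S.Atilde.toEuclideanLin lam S.xc) :
    ∃ (e : OrthonormalBasis (Fin 2) ℝ Plane) (mu b : ℝ), e 0 = ‖S.xc‖⁻¹ • S.xc ∧
      S.IsAdaptedFrame e ‖S.xc‖ lam mu b := by
  have hne : ‖S.xc‖ ≠ 0 := norm_ne_zero_iff.2 hxc.2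
  obtain ⟨e, he⟩ := exists_orthonormalBasis_head (u := ‖S.xc‖⁻¹ • S.xc) (by
    rw [norm_smul, norm_inv, norm_norm, inv_mul_cancel₀ hne])
  have h0 : S.Atilde.toEuclideanLin (e 0) = lam • e 0 := by
    rw [he, map_smul, hxc.apply_eq_smul, smul_comm]
  obtain ⟨b, mu, h1⟩ := exists_eq_smul_add_smul e (S.Atilde.toEuclideanLin (e 1))
  -- The eigenvalues of Ã are exactly `lam` and `mu`, so the Hurwitz property makes both negative.
  have heig := complexEigenvalues_eq_of_triangular e.toBasis (T := S.Atilde.toEuclideanLin)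
    (a := lam) (b := b) (d := mu) (by simpa using h0) (by simpa using h1)
  refine ⟨e, mu, b, he, hB, hG, hα.map_zero, hα_diff 0, hα_pos, hr, ?_, ?_, ?_, ?_, h0, h1⟩
  · rw [h, zero_sub, norm_neg, sub_pos] at h_origin
    exact lt_of_pow_lt_pow_left₀ 2 (norm_nonneg _) h_origin
  · simpa using hA lam (by rw [heig]; simp)
  · simpa using hA mu (by rw [heig]; simp)
  · rw [he, smul_smul, mul_inv_cancel₀ hne, one_smul]

end

theorem mainTheorem8 (S : FilterData)
    (hB : IsUnit S.B.det)
    (hG : ∀ x, S.G x = S.B.transpose * S.B)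
    (hα : IsExtendedClassKInfty S.α)
    (hα_diff : Differentiable ℝ S.α)
    (hα_pos : 0 < deriv S.α 0)
    (hr : 0 < S.r)
    (h_origin : 0 < S.h 0)
    (hA : IsHurwitz S.Atilde)
    (lam : ℝ)
    (hxc : Module.End.HasEigenvector S.Atilde.toEuclideanLin lam S.xc) :
    -- exactly one of the four configurations occurs
    (∃! c : EquilibriumConfiguration, S.HasConfiguration c) ∧
    -- `Ã` diagonalizable
    (∀ (lam' : ℝ) (vi vj : Plane), vi = ‖S.xc‖⁻¹ • S.xc → ‖vj‖ = 1 →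
      S.Atilde.toEuclideanLin vj = lam' • vj → LinearIndependent ℝ ![vi, vj] →
      ((lam - lam') ^ 2 * S.r ^ 2 / (lam ^ 2 * ‖S.xc‖ ^ 2) ≠ 1 →
        ((inner ℝ vi vj) ^ 2 < 1 - (lam - lam') ^ 2 * S.r ^ 2 / (lam ^ 2 * ‖S.xc‖ ^ 2) →
          S.HasConfiguration .oneSaddle) ∧
        ((inner ℝ vi vj) ^ 2 = 1 - (lam - lam') ^ 2 * S.r ^ 2 / (lam ^ 2 * ‖S.xc‖ ^ 2) →
          S.HasConfiguration .saddleAndDegenerate) ∧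
        ((inner ℝ vi vj) ^ 2 > 1 - (lam - lam') ^ 2 * S.r ^ 2 / (lam ^ 2 * ‖S.xc‖ ^ 2) →
          S.HasConfiguration .twoSaddlesAndStable)) ∧
      ((lam - lam') ^ 2 * S.r ^ 2 / (lam ^ 2 * ‖S.xc‖ ^ 2) = 1 →
        (inner ℝ vi vj = 0 → S.HasConfiguration .oneDegenerate) ∧
        (inner ℝ vi vj ≠ 0 → S.HasConfiguration .saddleAndDegenerate))) ∧
    -- `Ã` not diagonalizable
    (∀ v₁ v₂ : Plane, v₁ = ‖S.xc‖⁻¹ • S.xc →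
      S.Atilde.toEuclideanLin v₂ = lam • v₂ + v₁ →
        ((inner ℝ v₁ v₂) ^ 2 < ‖v₂‖ ^ 2 - S.r ^ 2 / (lam ^ 2 * ‖S.xc‖ ^ 2) →
          S.HasConfiguration .oneSaddle) ∧
        ((inner ℝ v₁ v₂) ^ 2 = ‖v₂‖ ^ 2 - S.r ^ 2 / (lam ^ 2 * ‖S.xc‖ ^ 2) →
          S.HasConfiguration .saddleAndDegenerate) ∧
        ((inner ℝ v₁ v₂) ^ 2 > ‖v₂‖ ^ 2 - S.r ^ 2 / (lam ^ 2 * ‖S.xc‖ ^ 2) →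
          S.HasConfiguration .twoSaddlesAndStable)) := by
  obtain ⟨e, mu, b, he, H⟩ := S.exists_isAdaptedFrame hB hG hα hα_diff hα_pos hr h_origin hA hxc
  have hgap := H.gap_pos
  have hlow := H.neg_lt_mul_radius
  have hcoord : ∀ p q : ℝ, inner ℝ (e 0) (p • e 0 + q • e 1) = p := fun p q => by
    have := inner_smul_add_smul e 1 0 p q
    simpa using this
  have haxis : ((lam - mu) * S.r) ^ 2 = (-lam * ‖S.xc‖) ^ 2 →
      (lam - mu) * S.r = -lam * ‖S.xc‖ := fun h =>
    (sq_eq_sq_iff_eq_or_eq_neg.1 h).resolve_right fun h => by linarith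
  have hk2 : lam ^ 2 * ‖S.xc‖ ^ 2 = (-lam * ‖S.xc‖) ^ 2 := by ring
  have hkpos : 0 < (-lam * ‖S.xc‖) ^ 2 := by positivity
  refine ⟨?_, ?_, ?_⟩
  · obtain ⟨C, hC⟩ := H.exists_hasConfiguration
    exact ⟨C, hC, fun C' hC' => hC'.unique hC⟩
  · rintro lam' vi vj hvi hvj hvj_eig hind
    rw [← he] at hvi
    subst hvi
    obtain ⟨p, q, rfl⟩ := exists_eq_smul_add_smul e vj
    have hpq : p ^ 2 + q ^ 2 = 1 := by
      rw [← norm_sq_smul_add_smul e, hvj, one_pow]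
    rw [H.map_smul_add_smul, smul_add, smul_smul, smul_smul, smul_add_smul_inj] at hvj_eig
    obtain ⟨h1, h2⟩ := hvj_eig
    have hq : q ≠ 0 := by
      rintro rfl
      have := LinearIndependent.pair_iff.1 hind p (-1) (by module)
      simp at this
    obtain rfl : mu = lam' := mul_right_cancel₀ hq h2
    have hup : (lam - mu) * p = -(b * q) := by linarith
    -- The eigenvector equation up = -bq together with p² + q² = 1. It turns the comparison of κ
    -- with q² = 1 - p² into that of (u² + b²)r² with k².
    have hN : q ^ 2 * ((lam - mu) ^ 2 + b ^ 2) = (lam - mu) ^ 2 := by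
      linear_combination (-((lam - mu) * p - b * q)) * hup + (lam - mu) ^ 2 * hpq
    have hq2 : 0 < q ^ 2 := by positivity
    rw [ne_eq, hcoord, hk2, div_eq_one_iff_eq hkpos.ne', ← hpq, ← mul_pow, lt_sub_iff_add_lt,
      add_lt_add_iff_left, div_lt_iff₀ hkpos, eq_sub_iff_add_eq, add_right_inj,
      div_eq_iff hkpos.ne', gt_iff_lt, sub_lt_iff_lt_add, add_lt_add_iff_left,
      lt_div_iff₀ hkpos]
    have hqN : ((lam - mu) * S.r) ^ 2 = q ^ 2 * (((lam - mu) ^ 2 + b ^ 2) * S.r ^ 2) := by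
      linear_combination (-S.r ^ 2) * hN
    refine ⟨fun hκ => ⟨fun h => ?_, fun h => ?_, fun h => ?_⟩, fun hκ => ⟨fun h => ?_, fun h => ?_⟩⟩
    · rw [hqN] at h
      exact H.hasConfiguration_oneSaddle (lt_of_mul_lt_mul_left h hq2.le)
    · refine H.hasConfiguration_saddleAndDegenerate_of_tangent
        (mul_left_cancel₀ hq2.ne' (hqN ▸ h)) ?_
      rintro rfl
      have h3 : q ^ 2 * (((lam - mu) * S.r) ^ 2 - (-lam * ‖S.xc‖) ^ 2) = 0 := by
        linear_combination h - hqN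
      exact hκ (sub_eq_zero.1 ((mul_eq_zero.1 h3).resolve_left hq2.ne'))
    · rw [hqN] at h
      exact H.hasConfiguration_twoSaddlesAndStable (lt_of_mul_lt_mul_left h hq2.le)
        fun h3 => hκ (by rw [h3])
    · refine H.hasConfiguration_oneDegenerate (haxis hκ) ?_
      rw [h, mul_zero, eq_comm, neg_eq_zero] at hup
      exact (mul_eq_zero.1 hup).resolve_right hq
    · refine H.hasConfiguration_saddleAndDegenerate_of_axis (haxis hκ) ?_
      -- If b = 0, then p ≠ 0 forces u = 0 and hence κ = 0, contradicting κ = 1.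
      rintro rfl
      rw [zero_mul, neg_zero] at hup
      have h3 := (mul_eq_zero.1 hup).resolve_right h
      rw [h3] at hκ
      linarith
  · rintro v₁ v₂ hv₁ hv₂
    rw [← he] at hv₁
    subst hv₁
    obtain ⟨p, q, rfl⟩ := exists_eq_smul_add_smul e v₂
    have hrhs : lam • (p • e 0 + q • e 1) + e 0 = (lam * p + 1) • e 0 + (lam * q) • e 1 := by
      module
    rw [H.map_smul_add_smul, hrhs, smul_add_smul_inj] at hv₂
    obtain ⟨h1, h2⟩ := hv₂
    have hbq : b * q = 1 := by linarith
    have hb : b ≠ 0 := left_ne_zero_of_mul_eq_one hbq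
    have hq : q ≠ 0 := right_ne_zero_of_mul_eq_one hbq
    obtain rfl : mu = lam := mul_right_cancel₀ hq h2
    have hq2 : 0 < q ^ 2 := by positivity
    rw [hcoord, norm_sq_smul_add_smul, hk2, lt_sub_iff_add_lt, add_lt_add_iff_left,
      div_lt_iff₀ hkpos, eq_sub_iff_add_eq, add_right_inj, div_eq_iff hkpos.ne', gt_iff_lt,
      sub_lt_iff_lt_add, add_lt_add_iff_left, lt_div_iff₀ hkpos]
    -- Here mu = lam, so u = 0, and bq = 1: the comparison of r²/k² with q² = ‖v₂‖² - p² is again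
    -- the discriminant, scaled by q².
    have hqN : S.r ^ 2 = q ^ 2 * (((mu - mu) ^ 2 + b ^ 2) * S.r ^ 2) := by
      linear_combination (-S.r ^ 2 * (b * q + 1)) * hbq
    refine ⟨fun h => ?_, fun h => ?_, fun h => ?_⟩
    · rw [hqN] at h
      exact H.hasConfiguration_oneSaddle (lt_of_mul_lt_mul_left h hq2.le)
    · exact H.hasConfiguration_saddleAndDegenerate_of_tangent
        (mul_left_cancel₀ hq2.ne' (hqN.symm.trans h)) hb
    · rw [hqN] at h
      refine H.hasConfiguration_twoSaddlesAndStable (lt_of_mul_lt_mul_left h hq2.le) fun h3 => ?_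
      rw [sub_self, zero_mul] at h3
      exact hgap.ne h3
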